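/- Let $\mathcal H_n=L^2(\mathbb R^n)$ be the Hilbert space of $n$ bosonic modes, and identify $\mathcal H_n^{\otimes k}$ with $L^2(\mathbb R^{n\times k})$, where $\psi^{\otimes k}(x_1,\dots,x_k)=\prod_j\psi(x_j)$ and $x_1,\dots,x_k\in\mathbb R^n$ are the columns of $x\in\mathbb R^{n\times k}$. For $o\in O(k)$ let $U_o$ be the unitary on $\mathcal H_n^{\otimes k}$ given by $(U_o\Psi)(x)=\Psi(xo)$. A pure Gaussian state is a pure state whose wavefunction is, up to a global phase, $$x\mapsto\Big(\frac{\det W}{\pi^n}\Big)^{1/4}\exp\Big(-\tfrac12(x-\bar x)^{\mathsf T}(W+iU)(x-\bar x)+i\,\bar p^{\mathsf T}(x-\bar x)\Big)$$ with $\bar x,\bar p\in\mathbb R^n$ and $W,U\in\mathbb R^{n\times n}$ symmetric, $W$ positive definite; it has zero mean if $\bar x=\bar p=0$. Let $\mathcal G$ be the set of pure Gaussian states and $\mathcal G_0$ the set of those with zero mean. For a unit vector $\psi\in\mathcal H_n$ and $\mathcal P\in\{\mathcal G,\mathcal G_0\}$ let $d_{\mathcal P}(\psi)=\inf_{\phi\in\mathcal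 P}\frac12\big\|\,|\psi\rangle\langle\psi|-|\phi\rangle\langle\phi|\,\big\|_1$ be its trace distance from $\mathcal P$. The state $\psi$ has even parity if $\psi(-x)=\psi(x)$ for almost every $x$. Each of the following tests measures $\{P,I-P\}$ on $k$ copies of $\psi$, where $P$ is an orthogonal projection, and accepts with probability $\operatorname{Tr}[P\,\psi^{\otimes k}]=\langle\psi^{\otimes k}|P|\psi^{\otimes k}\rangle$. - Test 1 ($k=2$): $P$ projects onto the vectors of the symmetric subspace $\mathrm{Sym}^2(\mathcal H_n)$ that are invariant under $U_{r_\theta}$ for all $\theta\in\mathbb R$, with $r_\theta=\begin{pmatrix}\cos\theta&-\sin\theta\\ \sin\theta&\cos\theta\end{pmatrix}$. - Test 2 ($k=2$): $P$ projects onto the vectors invariant under $U_{r_{\pi/4}}$. - Test 4 ($k=3$): $P$ projects onto the vectors invariant under $U_{s_\theta}$ for all $\theta\in\mathbb R$, where $s_\theta\in SO(3)$ is the rotation by the angle $\theta$ about the axis $(1,1,1)^{\mathsf T}$. - Test 5 ($k=3$): $P$ projects onto the vectors invariant under $U_{s_{\pi/3}}$. **Theorem.** There are universal constants $\varepsilon_0>0$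 and $c>0$ such that for every number of modes $n$ and every pure state $\psi\in\mathcal H_n$ the following hold. 1. If $\psi$ has even parity and $d_{\mathcal G_0}(\psi)=\varepsilon\le\varepsilon_0$, then Test 2, and likewise Test 1, accepts $\psi$ with probability at most $1-c\,\varepsilon^2$. 2. If $d_{\mathcal G}(\psi)=\varepsilon\le\varepsilon_0$, then Test 5, and likewise Test 4, accepts $\psi$ with probability at most $1-c\,\varepsilon^2$. -/

import Mathlib

open MeasureTheory
open scoped ENNReal InnerProductSpace

noncomputable section

namespace Bosonic

/-! ### Trace norm and trace distance -/

section TraceDistance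

variable {H : Type*} [NormedAddCommGroup H] [InnerProductSpace ℂ H] [CompleteSpace H]

/-- The index set of an orthonormal basis of `H`, fixed once and for all. -/
def basisIndex (H : Type*) [NormedAddCommGroup H] [InnerProductSpace ℂ H] [CompleteSpace H] :
    Set H :=
  (exists_hilbertBasis ℂ H).choose

/-- An orthonormal basis of `H`, fixed once and for all. -/
def basis (H : Type*) [NormedAddCommGroup H] [InnerProductSpace ℂ H] [CompleteSpace H] :
    HilbertBasis (basisIndex H) ℂ H :=
  (exists_hilbertBasis ℂ H).choose_spec.choose

/-- The trace norm `‖T‖₁ = Tr |T|`, where `|T| = √(T† T)`, of a bounded operator (it may be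
infinite). The trace of a positive operator does not depend on the orthonormal basis. -/
def traceNorm (T : H →L[ℂ] H) : ℝ≥0∞ :=
  ∑' i, ENNReal.ofReal (RCLike.re ⟪basis H i, CFC.abs T (basis H i)⟫_ℂ)

/-- The density operator `|ψ⟩⟨ψ|` of a ket `ψ`. -/
def density (ψ : H) : H →L[ℂ] H := InnerProductSpace.rankOne ℂ ψ ψ

/-- The trace distance `½ ‖ρ - σ‖₁`. -/
def traceDist (ρ σ : H →L[ℂ] H) : ℝ := (traceNorm (ρ - σ)).toReal / 2

/-- The trace distance from the pure state `ψ` to a family `P` of pure states (given as kets). -/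
def distTo (P : Set H) (ψ : H) : ℝ := ⨅ φ : P, traceDist (density ψ) (density (φ : H))

end TraceDistance

/-! ### Bosonic modes and pure Gaussian states -/

/-- The Hilbert space `L²(ℝⁿ)` of `n` modes. Only Lebesgue measure on `ℝⁿ` enters, not its norm. -/
abbrev Modes (n : ℕ) : Type := Lp ℂ 2 (volume : Measure (Fin n → ℝ))

/-- The wavefunction
`(det W / πⁿ)^(1/4) exp (-½ (x - a)ᵀ (W + iU) (x - a) + i pᵀ (x - a))`
of the pure Gaussian state with first moment `(a, p)`. -/
def gaussianWave {n : ℕ} (W U : Matrix (Fin n) (Fin n) ℝ) (a p : Fin n → ℝ) (x : Fin n → ℝ) : ℂ :=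
  (((W.det / Real.pi ^ n) ^ (1 / 4 : ℝ) : ℝ) : ℂ) *
    Complex.exp
      (-(1 / 2) * ∑ i, ∑ j,
          ((x i - a i : ℝ) : ℂ) * ((W i j : ℂ) + Complex.I * (U i j : ℂ)) * ((x j - a j : ℝ) : ℂ)
        + Complex.I * ∑ i, (p i : ℂ) * ((x i - a i : ℝ) : ℂ))

/-- `φ` is, up to a global phase, the pure Gaussian state with first moment `(a, p)`, for some
covariance matrix. -/
def IsGaussianWithMean {n : ℕ} (a p : Fin n → ℝ) (φ : Modes n) : Prop :=
  ∃ (W U : Matrix (Fin n) (Fin n) ℝ) (c : ℂ),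
    W.PosDef ∧ U.IsSymm ∧ ‖c‖ = 1 ∧ ∀ᵐ x, φ x = c * gaussianWave W U a p x

/-- The set `𝒢` of pure Gaussian states on `n` modes. -/
def gaussianStates (n : ℕ) : Set (Modes n) := {φ | ∃ a p, IsGaussianWithMean a p φ}

/-- The set `𝒢₀` of zero-mean pure Gaussian states on `n` modes. -/
def zeroMeanGaussianStates (n : ℕ) : Set (Modes n) := {φ | IsGaussianWithMean 0 0 φ}

/-- Even parity: invariance under the inversion `x ↦ -x`. -/
def IsEven {n : ℕ} (ψ : Modes n) : Prop := ∀ᵐ x, ψ (-x) = ψ x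

/-! ### Several copies and rotations between them -/

/-- The Hilbert space `L²(ℝ^{n × k}) ≅ L²(ℝⁿ)^{⊗ k}` of `k` copies of `n` modes; column `j` of
`x : ℝ^{n × k}` is the position of the `j`th copy. -/
abbrev Copies (n k : ℕ) : Type := Lp ℂ 2 (volume : Measure (Fin n → Fin k → ℝ))

/-- Transposition of an array of reals preserves Lebesgue measure. -/
theorem measurePreserving_transpose (n k : ℕ) :
    MeasurePreserving (fun (x : Fin n → Fin k → ℝ) (j : Fin k) (i : Fin n) => x i j)
      volume volume := by
  let e : (Fin n → Fin k → ℝ) ≃L[ℝ] (Fin k → Fin n → ℝ) :=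
    { toFun := fun x j i => x i j
      invFun := fun x i j => x j i
      map_add' := fun _ _ => rfl
      map_smul' := fun _ _ => rfl
      left_inv := fun _ => rfl
      right_inv := fun _ => rfl
      continuous_toFun := by fun_prop
      continuous_invFun := by fun_prop }
  have he : Measurable (fun (x : Fin n → Fin k → ℝ) (j : Fin k) (i : Fin n) => x i j) := by
    fun_prop
  refine ⟨he, ?_⟩
  have hv : ∀ a b : ℕ, Measure.IsAddHaarMeasure (volume : Measure (Fin a → Fin b → ℝ)) :=
    fun a b => Measure.pi.isAddHaarMeasure fun _ : Fin a => (volume : Measure (Fin b → ℝ))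
  have := hv n k
  have := hv k n
  have hh : Measure.IsAddHaarMeasure (Measure.map e (volume : Measure (Fin n → Fin k → ℝ))) :=
    e.isAddHaarMeasure_map _
  have key := Measure.isAddLeftInvariant_eq_smul
    (Measure.map e (volume : Measure (Fin n → Fin k → ℝ))) (volume : Measure (Fin k → Fin n → ℝ))
  have hcube : ∀ a b : ℕ, (volume : Measure (Fin a → Fin b → ℝ))
      (Set.univ.pi fun _ => Set.univ.pi fun _ => Set.Icc (0 : ℝ) 1) = 1 := by
    intro a b
    rw [volume_pi_pi, volume_pi_pi]
    simp
  have hmap : Measure.map e (volume : Measure (Fin n → Fin k → ℝ))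
      (Set.univ.pi fun _ => Set.univ.pi fun _ => Set.Icc (0 : ℝ) 1) = 1 := by
    rw [Measure.map_apply e.continuous.measurable]
    · rw [← hcube n k]
      congr 1
      ext x
      simp only [Set.mem_preimage, Set.mem_pi, Set.mem_univ, true_implies]
      exact ⟨fun h i j => h j i, fun h j i => h i j⟩
    · exact MeasurableSet.univ_pi fun _ => MeasurableSet.univ_pi fun _ => measurableSet_Icc
  have hone := hmap
  rw [key, Measure.smul_apply, hcube] at hone
  have hs : Measure.addHaarScalarFactor (Measure.map e (volume : Measure (Fin n → Fin k → ℝ)))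
      (volume : Measure (Fin k → Fin n → ℝ)) = 1 := by
    simpa [ENNReal.smul_def] using hone
  rw [hs, one_smul] at key
  exact key

/-- The wavefunction `x ↦ ∏ⱼ ψ(xⱼ)`, with `xⱼ` the columns of `x`, is square integrable. -/
theorem memLp_tensorPow {n : ℕ} (k : ℕ) (ψ : Modes n) :
    MemLp (fun x : Fin n → Fin k → ℝ => ∏ j, ψ (fun i => x i j)) 2 volume := by
  have h : MemLp (fun y : Fin k → Fin n → ℝ => ∏ j, ψ (y j)) 2 volume := by
    have hm : AEStronglyMeasurable (fun y : Fin k → Fin n → ℝ => ∏ j, ψ (y j)) volume := by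
      refine Finset.aestronglyMeasurable_fun_prod _ fun j _ => ?_
      exact (Lp.aestronglyMeasurable ψ).comp_quasiMeasurePreserving
        (Measure.quasiMeasurePreserving_eval _ j)
    rw [memLp_two_iff_integrable_sq_norm hm]
    have h2 : Integrable (fun z => ‖ψ z‖ ^ 2) volume :=
      (memLp_two_iff_integrable_sq_norm (Lp.aestronglyMeasurable ψ)).1 (Lp.memLp ψ)
    have := Integrable.fintype_prod (ι := Fin k) (f := fun _ z => ‖ψ z‖ ^ 2) (fun _ => h2)
    simp only [Finset.prod_pow, ← norm_prod] at this
    exact this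
  exact h.comp_measurePreserving (measurePreserving_transpose n k)

/-- The `k`-fold tensor power `ψ^{⊗ k}`. -/
def tensorPow {n : ℕ} (k : ℕ) (ψ : Modes n) : Copies n k := (memLp_tensorPow k ψ).toLp _

/-- Right multiplication of an `n × k` array by an orthogonal matrix preserves Lebesgue measure. -/
theorem measurePreserving_mul (n : ℕ) {k : ℕ} (o : Matrix.orthogonalGroup (Fin k) ℝ) :
    MeasurePreserving
      (fun (x : Fin n → Fin k → ℝ) (i : Fin n) => Matrix.vecMul (x i) (o : Matrix (Fin k) (Fin k) ℝ))
      volume volume := by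
  suffices h : MeasurePreserving
      (fun x : Fin k → ℝ => Matrix.vecMul x (o : Matrix (Fin k) (Fin k) ℝ)) volume volume from
    volume_preserving_pi fun _ : Fin n => h
  have hdet : |Matrix.det (o : Matrix (Fin k) (Fin k) ℝ)| = 1 := by
    have h := congrArg Matrix.det ((Matrix.mem_orthogonalGroup_iff _ _).1 o.2)
    rw [Matrix.det_mul, Matrix.det_transpose, Matrix.det_one] at h
    rcases mul_self_eq_one_iff.1 h with h | h <;> simp [h]
  have hne : Matrix.det (Matrix.transpose (o : Matrix (Fin k) (Fin k) ℝ)) ≠ 0 := by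
    rw [Matrix.det_transpose]
    intro h
    simp [h] at hdet
  have hmap := Real.map_matrix_volume_pi_eq_smul_volume_pi hne
  rw [Matrix.det_transpose, abs_inv, hdet] at hmap
  simp only [inv_one, ENNReal.ofReal_one, one_smul] at hmap
  have hfun : (fun x : Fin k → ℝ => Matrix.vecMul x (o : Matrix (Fin k) (Fin k) ℝ)) =
      Matrix.toLin' (Matrix.transpose (o : Matrix (Fin k) (Fin k) ℝ)) := by
    ext1 x
    rw [Matrix.toLin'_apply, Matrix.mulVec_transpose]
  refine ⟨?_, ?_⟩
  · rw [hfun]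
    exact (LinearMap.continuous_of_finiteDimensional _).measurable
  · rw [hfun]
    exact hmap

/-- The unitary `U_o` on `k` copies given by `(U_o Ψ)(x) = Ψ(x o)`, for `o ∈ O(k)`. -/
def rotate (n : ℕ) {k : ℕ} (o : Matrix.orthogonalGroup (Fin k) ℝ) :
    Copies n k →ₗᵢ[ℂ] Copies n k :=
  Lp.compMeasurePreservingₗᵢ ℂ
    (fun (x : Fin n → Fin k → ℝ) (i : Fin n) => Matrix.vecMul (x i) (o : Matrix (Fin k) (Fin k) ℝ))
    (measurePreserving_mul n o)

/-- The subspace of vectors that are invariant under `U_o` for all `o ∈ S`. -/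
def invariantSubspace (n : ℕ) {k : ℕ} (S : Set (Matrix.orthogonalGroup (Fin k) ℝ)) :
    Submodule ℂ (Copies n k) where
  carrier := {Ψ | ∀ o ∈ S, rotate n o Ψ = Ψ}
  add_mem' := fun ha hb o ho => by rw [map_add, ha o ho, hb o ho]
  zero_mem' := fun o _ => map_zero _
  smul_mem' := fun c Ψ h o ho => by rw [map_smul, h o ho]

theorem isClosed_invariantSubspace (n : ℕ) {k : ℕ} (S : Set (Matrix.orthogonalGroup (Fin k) ℝ)) :
    IsClosed (invariantSubspace n S : Set (Copies n k)) := by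
  have : (invariantSubspace n S : Set (Copies n k)) =
      ⋂ o ∈ S, {Ψ | rotate n o Ψ = Ψ} := by
    ext Ψ
    simp [invariantSubspace]
  rw [this]
  exact isClosed_biInter fun o _ => isClosed_eq (rotate n o).continuous continuous_id

instance instCompleteInvariantSubspace (n : ℕ) {k : ℕ}
    (S : Set (Matrix.orthogonalGroup (Fin k) ℝ)) : CompleteSpace (invariantSubspace n S) :=
  (isClosed_invariantSubspace n S).completeSpace_coe

/-- The probability `Tr[P ψ^{⊗ k}] = ⟨ψ^{⊗ k}| P |ψ^{⊗ k}⟩` of the outcome `P` when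
`{P, I - P}` is measured on `k` copies of the pure state `ψ`, where `P` is the orthogonal projection
onto the subspace of vectors invariant under `S ⊆ O(k)`. -/
def acceptProb {n k : ℕ} (S : Set (Matrix.orthogonalGroup (Fin k) ℝ)) (ψ : Modes n) : ℝ :=
  RCLike.re ⟪tensorPow k ψ, (invariantSubspace n S).starProjection (tensorPow k ψ)⟫_ℂ

/-- The rotation by `θ` between two copies. -/
def rot2 (θ : ℝ) : Matrix.orthogonalGroup (Fin 2) ℝ :=
  ⟨!![Real.cos θ, -Real.sin θ; Real.sin θ, Real.cos θ], by
    rw [Matrix.mem_orthogonalGroup_iff]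
    have h := Real.sin_sq_add_cos_sq θ
    ext i j
    fin_cases i <;> fin_cases j <;>
      simp [Matrix.mul_apply, Fin.sum_univ_two] <;> linarith⟩

/-- The exchange of two copies; `rotate n swap2` is the swap operator. -/
def swap2 : Matrix.orthogonalGroup (Fin 2) ℝ :=
  ⟨!![0, 1; 1, 0], by
    rw [Matrix.mem_orthogonalGroup_iff]
    ext i j
    fin_cases i <;> fin_cases j <;>
      simp [Matrix.mul_apply, Fin.sum_univ_two]⟩

/-- The rotation by `θ` about the axis `(1, 1, 1)` among three copies. -/
def rot3 (θ : ℝ) : Matrix.orthogonalGroup (Fin 3) ℝ :=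
  ⟨(1 / 3 : ℝ) •
    !![1 + 2 * Real.cos θ, 1 - Real.cos θ - √3 * Real.sin θ, 1 - Real.cos θ + √3 * Real.sin θ;
       1 - Real.cos θ + √3 * Real.sin θ, 1 + 2 * Real.cos θ, 1 - Real.cos θ - √3 * Real.sin θ;
       1 - Real.cos θ - √3 * Real.sin θ, 1 - Real.cos θ + √3 * Real.sin θ, 1 + 2 * Real.cos θ], by
    rw [Matrix.mem_orthogonalGroup_iff]
    have h : Real.sin θ ^ 2 = 1 - Real.cos θ ^ 2 := by
      have := Real.sin_sq_add_cos_sq θ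
      linarith
    have h3 : √(3 : ℝ) ^ 2 = 3 := Real.sq_sqrt (by norm_num)
    ext i j
    fin_cases i <;> fin_cases j <;>
      simp [Matrix.mul_apply, Fin.sum_univ_three] <;> ring_nf <;>
      rw [h3, h] <;> ring⟩

/-! ### The tests

The acceptance probabilities of the four tests on copies of the pure state `ψ`. -/

/-- Two copies, projection onto the rotation-invariant vectors in the symmetric subspace. -/
def acceptTest1 {n : ℕ} (ψ : Modes n) : ℝ := acceptProb (insert swap2 (Set.range rot2)) ψ

/-- Two copies, projection onto the vectors invariant under the rotation by `π/4`. -/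
def acceptTest2 {n : ℕ} (ψ : Modes n) : ℝ := acceptProb {rot2 (Real.pi / 4)} ψ

/-- Three copies, projection onto the vectors invariant under all rotations about `(1, 1, 1)`. -/
def acceptTest4 {n : ℕ} (ψ : Modes n) : ℝ := acceptProb (Set.range rot3) ψ

/-- Three copies, projection onto the vectors invariant under the rotation by `π/3` about
`(1, 1, 1)`. -/
def acceptTest5 {n : ℕ} (ψ : Modes n) : ℝ := acceptProb {rot3 (Real.pi / 3)} ψ

end Bosonic

end

noncomputable section

namespace Bosonic

open scoped ComplexConjugate

/-! ### Trace distance between pure states -/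

section TraceDistance

set_option linter.unusedSectionVars false

variable {H : Type*} [NormedAddCommGroup H] [InnerProductSpace ℂ H] [CompleteSpace H]

/-! Let φ be a nearly closest Gaussian state and write ψ = αφ + χ with χ ⊥ φ; by
`traceDist_density`, ‖χ‖ lies between ε and 2ε. A Gaussian unitary (`GaussianFrame.pull`) carries
the vacuum to φ and grades the space by Hermite degree. Near-optimality of φ against the Gaussian
deformations φ·exp(tωq), with q a product of one or two normalized coordinates, makes the components
of χ of degree 1 and 2 negligible (`exists_forall_norm_inner_le`). Degree 0 vanishes because χ ⊥ φ.
Linear deformations move the mean and leave 𝒢₀; in that case degree 1 vanishes because ψ is even.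

To first order ψ^{⊗k} = α^k φ^{⊗k} + α^{k-1} v, where v is the sum over slots of χ among copies of φ
(`norm_tensorPow_sub_le`). The rotation o fixes φ^{⊗k}. Coherent states serve as a generating
function and give ⟨v, U_o v⟩ = ∑_m (∑_{j,l} o_{jl}^m) w_m, with w_m the weight of χ in degree m,
whereas ‖v‖² = k ∑_m w_m. In degree 2 the coefficient is k for every orthogonal o, so no rotation
detects it; this is why optimality is needed. From degree 3 on it is at most k − 1 for the angles
π/4 and π/3. Hence ‖v − U_o v‖ ≥ ‖χ‖ (`norm_sub_rotate_slotSum_ge`), the second-order error is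
absorbed for small ε, and a test whose accepted vectors are fixed by U_o rejects with probability at
least ¼‖Ψ − U_oΨ‖² (`acceptProb_le`). Tests 1 and 4 accept subspaces of those of Tests 2 and 5, so
the same bound applies to them.

No minimizer is required: a near-minimizer with tolerance depending on n and ε suffices, and the
tolerance does not enter the final constants. -/

theorem density_apply (ψ x : H) : density ψ x = ⟪ψ, x⟫_ℂ • ψ := by
  simp [density]

theorem inner_mul_inner_swap (ψ φ : H) : ⟪φ, ψ⟫_ℂ * ⟪ψ, φ⟫_ℂ = ((‖⟪ψ, φ⟫_ℂ‖ ^ 2 : ℝ) : ℂ) := by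
  rw [← inner_conj_symm, Complex.conj_mul']
  norm_cast

theorem isSelfAdjoint_density (ψ : H) : IsSelfAdjoint (density ψ) := by
  rw [ContinuousLinearMap.isSelfAdjoint_iff_isSymmetric]
  intro x y
  simp [density_apply, inner_smul_left, inner_smul_right, mul_comm]

/-- The difference of two rank-one projections squares to a projection up to a scalar. -/
theorem density_sub_pow_four {ψ φ : H} (hψ : ‖ψ‖ = 1) (hφ : ‖φ‖ = 1) :
    ((density ψ - density φ) * (density ψ - density φ)) *
      ((density ψ - density φ) * (density ψ - density φ)) =
      ((1 - ‖⟪ψ, φ⟫_ℂ‖ ^ 2 : ℝ) : ℂ) • ((density ψ - density φ) * (density ψ - density φ)) := by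
  have h1 : ⟪ψ, ψ⟫_ℂ = 1 := by simp [inner_self_eq_norm_sq_to_K, hψ]
  have h2 : ⟪φ, φ⟫_ℂ = 1 := by simp [inner_self_eq_norm_sq_to_K, hφ]
  have h3 : ((1 - ‖⟪ψ, φ⟫_ℂ‖ ^ 2 : ℝ) : ℂ) = 1 - ⟪φ, ψ⟫_ℂ * ⟪ψ, φ⟫_ℂ := by
    rw [inner_mul_inner_swap]
    push_cast
    ring
  ext x
  simp only [h3, mul_apply_eq_comp, sub_apply, density_apply,
    smul_apply, inner_sub_right, inner_smul_right, h1, h2]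
  module

/-- With T the difference and s² = 1 − |⟨ψ,φ⟩|², the identity T⁴ = s²T² gives s|T| = T². So s·Tr|T|
is the squared Hilbert–Schmidt norm of T, which Parseval evaluates to 2s². -/
theorem traceDist_density {ψ φ : H} (hψ : ‖ψ‖ = 1) (hφ : ‖φ‖ = 1) :
    traceDist (density ψ) (density φ) = √(1 - ‖⟪ψ, φ⟫_ℂ‖ ^ 2) := by
  set T : H →L[ℂ] H := density ψ - density φ with hT
  set s : ℝ := √(1 - ‖⟪ψ, φ⟫_ℂ‖ ^ 2) with hs
  have hle : ‖⟪ψ, φ⟫_ℂ‖ ≤ 1 := by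
    simpa [hψ, hφ] using norm_inner_le_norm (𝕜 := ℂ) ψ φ
  have hss : s ^ 2 = 1 - ‖⟪ψ, φ⟫_ℂ‖ ^ 2 := by
    rw [hs, Real.sq_sqrt]
    nlinarith [norm_nonneg ⟪ψ, φ⟫_ℂ]
  have hsa : IsSelfAdjoint T := (isSelfAdjoint_density ψ).sub (isSelfAdjoint_density φ)
  have hsym : ∀ x y, ⟪T x, y⟫_ℂ = ⟪x, T y⟫_ℂ := (ContinuousLinearMap.isSelfAdjoint_iff_isSymmetric.1 hsa)
  have hpow := density_sub_pow_four hψ hφ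
  rw [← hT, ← hss] at hpow
  have hnorm : ∀ x, ‖T x‖ ^ 2 = RCLike.re ⟪x, (T * T) x⟫_ℂ := fun x => by
    rw [mul_apply_eq_comp, ← hsym x (T x), inner_self_eq_norm_sq]
  have hsum : HasSum (fun i => ‖T (basis H i)‖ ^ 2) (2 * s ^ 2) := by
    have e : ∀ i, ((‖T (basis H i)‖ ^ 2 : ℝ) : ℂ) =
        ⟪ψ, basis H i⟫_ℂ * ⟪basis H i, ψ⟫_ℂ + ⟪φ, basis H i⟫_ℂ * ⟪basis H i, φ⟫_ℂ
        - ⟪ψ, φ⟫_ℂ * (⟪φ, basis H i⟫_ℂ * ⟪basis H i, ψ⟫_ℂ)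
        - ⟪φ, ψ⟫_ℂ * (⟪ψ, basis H i⟫_ℂ * ⟪basis H i, φ⟫_ℂ) := fun i => by
      have h1 : ⟪ψ, ψ⟫_ℂ = 1 := by simp [inner_self_eq_norm_sq_to_K, hψ]
      have h2 : ⟪φ, φ⟫_ℂ = 1 := by simp [inner_self_eq_norm_sq_to_K, hφ]
      have : ((‖T (basis H i)‖ ^ 2 : ℝ) : ℂ) = ⟪T (basis H i), T (basis H i)⟫_ℂ := by
        rw [inner_self_eq_norm_sq_to_K]; norm_cast
      rw [this, hsym (basis H i) (T (basis H i))]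
      simp only [hT, sub_apply, density_apply, inner_sub_right,
        inner_smul_right, h1, h2]
      ring
    have key := ((((basis H).hasSum_inner_mul_inner ψ ψ).add
      ((basis H).hasSum_inner_mul_inner φ φ)).sub
      (((basis H).hasSum_inner_mul_inner φ ψ).mul_left ⟪ψ, φ⟫_ℂ)).sub
      (((basis H).hasSum_inner_mul_inner ψ φ).mul_left ⟪φ, ψ⟫_ℂ)
    simp only [← e] at key
    have hval : ⟪ψ, ψ⟫_ℂ + ⟪φ, φ⟫_ℂ - ⟪ψ, φ⟫_ℂ * ⟪φ, ψ⟫_ℂ - ⟪φ, ψ⟫_ℂ * ⟪ψ, φ⟫_ℂ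
        = ((2 * s ^ 2 : ℝ) : ℂ) := by
      rw [mul_comm ⟪ψ, φ⟫_ℂ, inner_mul_inner_swap ψ φ, hss]
      simp [inner_self_eq_norm_sq_to_K, hψ, hφ]
      ring
    rw [hval] at key
    exact_mod_cast key
  have habs : (s : ℂ) • CFC.abs T = T * T := by
    -- For s = 0 the formula |T| = T²/s is meaningless, but then the Hilbert–Schmidt sum forces T =
    -- 0.
    rcases eq_or_ne s 0 with h0 | h0
    · have : T = 0 := by
        have hz : ∀ i, ‖T (basis H i)‖ ^ 2 = 0 := by
          rw [h0] at hsum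
          have := (hasSum_zero_iff_of_nonneg (fun i => by positivity)).1
            (by simpa using hsum : HasSum (fun i => ‖T (basis H i)‖ ^ 2) 0)
          exact fun i => congrFun this i
        have hd := (basis H).dense_span
        apply ContinuousLinearMap.ext_on (s := Set.range (basis H))
        · rw [dense_iff_closure_eq, ← Submodule.topologicalClosure_coe, hd]; rfl
        · rintro _ ⟨i, rfl⟩
          simpa using hz i
      simp [this, h0]
    · have hspos : 0 < s := lt_of_le_of_ne (Real.sqrt_nonneg _) (Ne.symm h0)
      have hTT : 0 ≤ T * T := by
        have := star_mul_self_nonneg T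
        rwa [hsa.star_eq] at this
      have h := CFC.sqrt_unique (a := star T * T) (b := (s⁻¹ : ℝ) • (T * T))
        (by
          rw [smul_mul_smul_comm, hpow, hsa.star_eq]
          rw [Complex.coe_smul, smul_smul]
          field_simp
          simp) (smul_nonneg (by positivity) hTT)
      rw [CFC.abs, h, Complex.coe_smul, smul_smul, mul_inv_cancel₀ h0, one_smul]
  have hterm : ∀ i, s * RCLike.re ⟪basis H i, CFC.abs T (basis H i)⟫_ℂ = ‖T (basis H i)‖ ^ 2 := by
    intro i
    rw [hnorm, ← habs, smul_apply, inner_smul_right]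
    simp
  have htr : traceNorm T = ENNReal.ofReal (2 * s) := by
    rcases eq_or_ne s 0 with h0 | h0
    · have hT0 : T = 0 := by
        have hn : T * T = 0 := by rw [← habs, h0]; simp
        ext x
        have := hnorm x
        rw [hn] at this
        simpa using this
      simp [traceNorm, hT0, h0]
    · have hspos : 0 < s := lt_of_le_of_ne (Real.sqrt_nonneg _) (Ne.symm h0)
      have hh : HasSum (fun i => RCLike.re ⟪basis H i, CFC.abs T (basis H i)⟫_ℂ) (2 * s) := by
        have := hsum.mul_left s⁻¹
        simp only [← hterm, inv_mul_cancel_left₀ h0] at this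
        rwa [show s⁻¹ * (2 * s ^ 2) = 2 * s by field_simp] at this
      rw [traceNorm, ← hh.tsum_eq, ENNReal.ofReal_tsum_of_nonneg _ hh.summable]
      intro i
      have := hterm i
      have h2 : 0 ≤ s * RCLike.re ⟪basis H i, CFC.abs T (basis H i)⟫_ℂ := by
        rw [this]; positivity
      exact nonneg_of_mul_nonneg_right h2 hspos
  rw [traceDist, ← hT, htr, ENNReal.toReal_ofReal (by positivity)]
  ring


/-! ### First-order conditions at an almost maximal overlap -/

theorem norm_add_smul_sq (φ h : H) (t : ℝ) :
    ‖φ + (t : ℂ) • h‖ ^ 2 = ‖φ‖ ^ 2 + 2 * t * (⟪h, φ⟫_ℂ).re + t ^ 2 * ‖h‖ ^ 2 := by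
  have h1 : (⟪φ, h⟫_ℂ).re = (⟪h, φ⟫_ℂ).re := by rw [← inner_conj_symm, Complex.conj_re]
  rw [@norm_add_sq ℂ, inner_smul_right, norm_smul, Complex.norm_real, Real.norm_eq_abs, mul_pow,
    sq_abs, ← h1]
  simp
  ring

theorem norm_add_smul_le {φ h : H} {t K : ℝ} (hφ : ‖φ‖ ≤ 1) (hh : ‖h‖ ≤ K) (ht : 0 ≤ t)
    (ht1 : t ≤ 1) : ‖φ + (t : ℂ) • h‖ ≤ 1 + K := by
  refine (norm_add_le _ _).trans ?_
  rw [norm_smul, Complex.norm_real, Real.norm_eq_abs, abs_of_nonneg ht]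
  nlinarith [norm_nonneg h]

theorem norm_inner_sq_ge_of_first_order {φ h g ψ : H} {t e K : ℝ} (hφ : ‖φ‖ = 1) (hh : ‖h‖ ≤ K)
    (hψ : ‖ψ‖ = 1) (ht : 0 ≤ t) (ht1 : t ≤ 1) (hg : ‖g - (φ + (t : ℂ) • h)‖ ≤ e) :
    ‖⟪φ, ψ⟫_ℂ‖ ^ 2 + 2 * t * (conj ⟪φ, ψ⟫_ℂ * ⟪h, ψ⟫_ℂ).re - 2 * (1 + K) * e ≤
      ‖⟪g, ψ⟫_ℂ‖ ^ 2 := by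
  have he : 0 ≤ e := (norm_nonneg _).trans hg
  have hβ : ‖⟪h, ψ⟫_ℂ‖ ≤ K := (norm_inner_le_norm h ψ).trans (by rw [hψ, mul_one]; exact hh)
  have hα : ‖⟪φ, ψ⟫_ℂ‖ ≤ 1 := by simpa [hφ, hψ] using norm_inner_le_norm (𝕜 := ℂ) φ ψ
  have hs : ⟪φ + (t : ℂ) • h, ψ⟫_ℂ = ⟪φ, ψ⟫_ℂ + (t : ℂ) • ⟪h, ψ⟫_ℂ := by
    rw [inner_add_left, inner_smul_left, Complex.conj_ofReal, smul_eq_mul]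
  have h1 : ‖⟪g - (φ + (t : ℂ) • h), ψ⟫_ℂ‖ ≤ e :=
    (norm_inner_le_norm _ _).trans (by rw [hψ, mul_one]; exact hg)
  have hover : ‖⟪φ, ψ⟫_ℂ + (t : ℂ) • ⟪h, ψ⟫_ℂ‖ - e ≤ ‖⟪g, ψ⟫_ℂ‖ := by
    have h2 := norm_sub_le ⟪g, ψ⟫_ℂ ⟪g - (φ + (t : ℂ) • h), ψ⟫_ℂ
    rw [← inner_sub_left, sub_sub_cancel, hs] at h2
    linarith
  have hαβ := norm_add_smul_le hα hβ ht ht1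
  have hexp := norm_add_smul_sq ⟪φ, ψ⟫_ℂ ⟪h, ψ⟫_ℂ t
  have hre : (⟪⟪h, ψ⟫_ℂ, ⟪φ, ψ⟫_ℂ⟫_ℂ).re = (conj ⟪φ, ψ⟫_ℂ * ⟪h, ψ⟫_ℂ).re := by
    rw [RCLike.inner_apply]
    generalize ⟪φ, ψ⟫_ℂ = α
    generalize ⟪h, ψ⟫_ℂ = β
    simp
  rw [hre] at hexp
  have hx0 := norm_nonneg (⟪φ, ψ⟫_ℂ + (t : ℂ) • ⟪h, ψ⟫_ℂ)
  have hβ0 : 0 ≤ t ^ 2 * ‖⟪h, ψ⟫_ℂ‖ ^ 2 := by positivity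
  generalize ‖⟪φ, ψ⟫_ℂ + (t : ℂ) • ⟪h, ψ⟫_ℂ‖ = x at *
  have hx : x ^ 2 - 2 * (1 + K) * e ≤ ‖⟪g, ψ⟫_ℂ‖ ^ 2 := by
    -- Squaring x − e ≤ |⟨g,ψ⟩| needs e ≤ x; otherwise x² ≤ (1+K)e and the left side is nonpositive.
    rcases le_or_gt e x with hle | hlt
    · have := pow_le_pow_left₀ (sub_nonneg.2 hle) hover 2
      nlinarith
    · have := mul_le_mul hαβ hlt.le hx0 (hx0.trans hαβ)
      nlinarith [sq_nonneg ‖⟪g, ψ⟫_ℂ‖]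
  linarith

theorem norm_sq_le_of_first_order {φ h g : H} {t e K : ℝ} (hφ : ‖φ‖ = 1) (hh : ‖h‖ ≤ K)
    (ht : 0 ≤ t) (ht1 : t ≤ 1) (hg : ‖g - (φ + (t : ℂ) • h)‖ ≤ e) :
    ‖g‖ ^ 2 ≤ 1 + 2 * t * (⟪h, φ⟫_ℂ).re + t ^ 2 * K ^ 2 + 2 * (1 + K) * e + e ^ 2 ∧
      ‖g‖ ≤ 1 + K + e := by
  have he : 0 ≤ e := (norm_nonneg _).trans hg
  have hgn : ‖g‖ ≤ ‖φ + (t : ℂ) • h‖ + e := by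
    have := norm_add_le (φ + (t : ℂ) • h) (g - (φ + (t : ℂ) • h))
    rw [add_sub_cancel] at this
    linarith
  have hl := norm_add_smul_le hφ.le hh ht ht1
  have h1 := pow_le_pow_left₀ (norm_nonneg _) hgn 2
  have h2 := norm_add_smul_sq φ h t
  have h3 : t ^ 2 * ‖h‖ ^ 2 ≤ t ^ 2 * K ^ 2 := by gcongr
  rw [hφ] at h2
  refine ⟨?_, by linarith⟩
  nlinarith

/-- If the overlap with `ψ` of the normalized vectors on a curve `g t = φ + t h + O(t²)` is almost
maximal at `t = 0`, then `h` is almost orthogonal to the component of `ψ` orthogonal to `φ`, in the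
direction of the phase of `⟪φ, ψ⟫`. -/
theorem exists_forall_re_inner_le_of_almost_maximal (C t₀ K η : ℝ) (hC : 0 ≤ C) (ht₀ : 0 < t₀)
    (hK : 0 ≤ K) (hη : 0 < η) :
    ∃ δ : ℝ, 0 < δ ∧ ∀ (φ h ψ : H) (g : ℝ → H) (M : ℝ), ‖φ‖ = 1 → ‖h‖ ≤ K → ‖ψ‖ = 1 →
      (∀ t, 0 ≤ t → t ≤ t₀ → ‖g t - (φ + (t : ℂ) • h)‖ ≤ C * t ^ 2) →
      (∀ t, 0 ≤ t → t ≤ t₀ → ‖⟪g t, ψ⟫_ℂ‖ ^ 2 ≤ ‖g t‖ ^ 2 * M) →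
      M - δ ≤ ‖⟪φ, ψ⟫_ℂ‖ ^ 2 →
      (conj ⟪φ, ψ⟫_ℂ * ⟪h, ψ - ⟪φ, ψ⟫_ℂ • φ⟫_ℂ).re ≤ η := by
  -- D₁t² collects the remainders of the overlap and of the norm, and D₂ bounds ‖g t‖². At one fixed
  -- t, both tD₁ and D₂δ/t are at most η; together they bound twice the first-order coefficient.
  set D₁ : ℝ := K ^ 2 + 4 * (1 + K) * C + C ^ 2 with hD₁
  have hD₁0 : 0 ≤ D₁ := by positivity
  set D₂ : ℝ := (1 + K + C) ^ 2 with hD₂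
  have hD₂0 : 0 < D₂ := by positivity
  set t : ℝ := min t₀ (min 1 (η / (D₁ + 1))) with ht
  have htpos : 0 < t := by
    have : 0 < η / (D₁ + 1) := by positivity
    simp only [ht, lt_min_iff]
    exact ⟨ht₀, one_pos, this⟩
  have ht1 : t ≤ 1 := (min_le_right _ _).trans (min_le_left _ _)
  have htη : t * D₁ ≤ η := by
    have h1 : t ≤ η / (D₁ + 1) := (min_le_right _ _).trans (min_le_right _ _)
    rw [le_div_iff₀ (by positivity)] at h1
    linarith
  refine ⟨t * η / D₂, by positivity, ?_⟩
  intro φ h ψ g M hφ hh hψ hg hM hα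
  have hgt := hg t htpos.le (min_le_left _ _)
  have hMt := hM t htpos.le (min_le_left _ _)
  have hlow := norm_inner_sq_ge_of_first_order hφ hh hψ htpos.le ht1 hgt
  obtain ⟨hup, hup'⟩ := norm_sq_le_of_first_order hφ hh htpos.le ht1 hgt
  have ht2 : t ^ 2 ≤ 1 := pow_le_one₀ htpos.le ht1
  have hCt : C * t ^ 2 ≤ C := mul_le_of_le_one_right hC ht2
  have hα1 : ‖⟪φ, ψ⟫_ℂ‖ ^ 2 ≤ 1 := by
    have : ‖⟪φ, ψ⟫_ℂ‖ ≤ 1 := by simpa [hφ, hψ] using norm_inner_le_norm (𝕜 := ℂ) φ ψ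
    exact pow_le_one₀ (norm_nonneg _) this
  have hα0 : 0 ≤ ‖⟪φ, ψ⟫_ℂ‖ ^ 2 := by positivity
  have hgoal : (conj ⟪φ, ψ⟫_ℂ * ⟪h, ψ - ⟪φ, ψ⟫_ℂ • φ⟫_ℂ).re =
      (conj ⟪φ, ψ⟫_ℂ * ⟪h, ψ⟫_ℂ).re - ‖⟪φ, ψ⟫_ℂ‖ ^ 2 * (⟪h, φ⟫_ℂ).re := by
    rw [inner_sub_right, inner_smul_right, mul_sub, ← mul_assoc, Complex.conj_mul', Complex.sub_re]
    congr 1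
    rw [← Complex.ofReal_pow, Complex.re_ofReal_mul]
  rw [hgoal]
  have hgD : ‖g t‖ ^ 2 ≤ D₂ :=
    pow_le_pow_left₀ (norm_nonneg _) (hup'.trans (by linarith)) 2
  have hδ : ‖g t‖ ^ 2 * (t * η / D₂) ≤ t * η := by
    calc _ ≤ D₂ * (t * η / D₂) := mul_le_mul_of_nonneg_right hgD (by positivity)
      _ = t * η := by field_simp
  have hM2 : ‖g t‖ ^ 2 * M ≤ ‖g t‖ ^ 2 * ‖⟪φ, ψ⟫_ℂ‖ ^ 2 + t * η := by
    have : ‖g t‖ ^ 2 * M ≤ ‖g t‖ ^ 2 * (‖⟪φ, ψ⟫_ℂ‖ ^ 2 + t * η / D₂) :=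
      mul_le_mul_of_nonneg_left (by linarith) (by positivity)
    rw [mul_add] at this
    linarith
  have hE : t ^ 2 * K ^ 2 + 2 * (1 + K) * (C * t ^ 2) + (C * t ^ 2) ^ 2 ≤
      t ^ 2 * (K ^ 2 + 2 * (1 + K) * C + C ^ 2) := by
    have : (C * t ^ 2) ^ 2 ≤ t ^ 2 * C ^ 2 := by
      calc (C * t ^ 2) ^ 2 = t ^ 2 * C ^ 2 * t ^ 2 := by ring
        _ ≤ t ^ 2 * C ^ 2 := mul_le_of_le_one_right (by positivity) ht2
    linarith
  have hA := mul_le_mul_of_nonneg_right (hup.trans (by linarith :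
    _ ≤ 1 + 2 * t * (⟪h, φ⟫_ℂ).re + t ^ 2 * (K ^ 2 + 2 * (1 + K) * C + C ^ 2))) hα0
  have hE0 : 0 ≤ t ^ 2 * (K ^ 2 + 2 * (1 + K) * C + C ^ 2) := by positivity
  have hB := mul_le_mul_of_nonneg_left hα1 hE0
  have e : t * (t * D₁) = t ^ 2 * (K ^ 2 + 2 * (1 + K) * C + C ^ 2) +
    2 * (1 + K) * (C * t ^ 2) := by rw [hD₁]; ring
  have : t * (t * D₁) ≤ t * η := mul_le_mul_of_nonneg_left htη htpos.le
  have hfin : t * ((conj ⟪φ, ψ⟫_ℂ * ⟪h, ψ⟫_ℂ).re - ‖⟪φ, ψ⟫_ℂ‖ ^ 2 * (⟪h, φ⟫_ℂ).re) ≤ t * η := by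
    linarith
  exact le_of_mul_le_mul_left hfin htpos

end TraceDistance

/-! ### Acceptance probability from the displacement under one rotation -/

/-- A test accepts with probability at most `1 - ¼ ‖Ψ - U Ψ‖²`, if the accepted vectors are
invariant under `U`. -/
theorem acceptProb_le {n k : ℕ} {S : Set (Matrix.orthogonalGroup (Fin k) ℝ)} {ψ : Modes n}
    (hψ : ‖tensorPow k ψ‖ = 1) {o : Matrix.orthogonalGroup (Fin k) ℝ} (ho : o ∈ S) :
    acceptProb S ψ ≤ 1 - ‖tensorPow k ψ - rotate n o (tensorPow k ψ)‖ ^ 2 / 4 := by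
  set Ψ := tensorPow k ψ
  set K := invariantSubspace n S
  have h1 : acceptProb S ψ = ‖K.starProjection Ψ‖ ^ 2 := by
    rw [acceptProb, ← Submodule.inner_starProjection_left_eq_right,
      Submodule.re_inner_starProjection_eq_normSq, Submodule.starProjection_apply, Submodule.coe_norm]
  have h2 : ‖Ψ‖ ^ 2 = ‖K.starProjection Ψ‖ ^ 2 + ‖Ψ - K.starProjection Ψ‖ ^ 2 := by
    rw [Submodule.norm_sq_eq_add_norm_sq_starProjection Ψ K, Submodule.starProjection_orthogonal]
    rfl
  -- The projection of Ψ is fixed by the rotation, so only the complementary part moves, by at most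
  -- twice its norm.
  have h3 : ‖Ψ - rotate n o Ψ‖ ≤ 2 * ‖Ψ - K.starProjection Ψ‖ := by
    have hinv : rotate n o (K.starProjection Ψ) = K.starProjection Ψ :=
      (Submodule.starProjection_apply_mem K Ψ) o ho
    have : Ψ - rotate n o Ψ =
        (Ψ - K.starProjection Ψ) - rotate n o (Ψ - K.starProjection Ψ) := by
      rw [map_sub, hinv]; abel
    rw [this]
    refine (norm_sub_le _ _).trans ?_
    rw [LinearIsometry.norm_map]
    linarith
  have h4 := pow_le_pow_left₀ (norm_nonneg _) h3 2
  rw [h1]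
  rw [hψ] at h2
  nlinarith

/-! ### Tensor products of wavefunctions -/

theorem quasiMeasurePreserving_column (n : ℕ) {k : ℕ} (j : Fin k) :
    Measure.QuasiMeasurePreserving (fun (x : Fin n → Fin k → ℝ) (i : Fin n) => x i j)
      volume volume :=
  (Measure.quasiMeasurePreserving_eval (fun _ : Fin k => (volume : Measure (Fin n → ℝ))) j).comp
    (measurePreserving_transpose n k).quasiMeasurePreserving

theorem memLp_tensor {n k : ℕ} (f : Fin k → Modes n) :
    MemLp (fun x : Fin n → Fin k → ℝ => ∏ j, f j (fun i => x i j)) 2 volume := by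
  have h : MemLp (fun y : Fin k → Fin n → ℝ => ∏ j, f j (y j)) 2 volume := by
    have hm : AEStronglyMeasurable (fun y : Fin k → Fin n → ℝ => ∏ j, f j (y j)) volume :=
      Finset.aestronglyMeasurable_fun_prod _ fun j _ =>
        (Lp.aestronglyMeasurable (f j)).comp_quasiMeasurePreserving
          (Measure.quasiMeasurePreserving_eval _ j)
    rw [memLp_two_iff_integrable_sq_norm hm]
    have h2 : ∀ j, Integrable (fun z => ‖f j z‖ ^ 2) volume := fun j =>
      (memLp_two_iff_integrable_sq_norm (Lp.aestronglyMeasurable (f j))).1 (Lp.memLp (f j))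
    have := Integrable.fintype_prod (ι := Fin k) (f := fun j z => ‖f j z‖ ^ 2) h2
    simp only [Finset.prod_pow, ← norm_prod] at this
    exact this
  exact h.comp_measurePreserving (measurePreserving_transpose n k)

/-- Equality almost everywhere of the factors gives equality of the product functions. -/
theorem tensor_ae_congr {n k : ℕ} {f g : Fin k → (Fin n → ℝ) → ℂ} (h : ∀ j, f j =ᵐ[volume] g j) :
    (fun x : Fin n → Fin k → ℝ => ∏ j, f j (fun i => x i j)) =ᵐ[volume]
      fun x => ∏ j, g j (fun i => x i j) := by
  have : ∀ᵐ x : Fin n → Fin k → ℝ, ∀ j, f j (fun i => x i j) = g j (fun i => x i j) :=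
    ae_all_iff.2 fun j => (quasiMeasurePreserving_column n j).ae_eq_comp (h j)
  filter_upwards [this] with x hx
  exact Finset.prod_congr rfl fun j _ => hx j

/-- The tensor product `f₁ ⊗ ⋯ ⊗ f_k`, with wavefunction `x ↦ ∏ⱼ fⱼ(xⱼ)`. -/
def tensor (n k : ℕ) : MultilinearMap ℂ (fun _ : Fin k => Modes n) (Copies n k) where
  toFun f := (memLp_tensor f).toLp _
  map_update_add' := by
    intro _ f j a b
    rw [← MemLp.toLp_add, MemLp.toLp_eq_toLp_iff]
    have hs : ∀ᵐ x : Fin n → Fin k → ℝ, (a + b) (fun i => x i j) =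
        a (fun i => x i j) + b (fun i => x i j) :=
      (quasiMeasurePreserving_column n j).ae_eq_comp (Lp.coeFn_add a b)
    filter_upwards [hs] with x hx
    simp only [Pi.add_apply]
    rw [← Finset.mul_prod_erase _ _ (Finset.mem_univ j),
      ← Finset.mul_prod_erase _ (fun l => (Function.update f j a l) _) (Finset.mem_univ j),
      ← Finset.mul_prod_erase _ (fun l => (Function.update f j b l) _) (Finset.mem_univ j)]
    have he : ∀ c : Modes n, ∏ l ∈ Finset.univ.erase j, (Function.update f j c l) (fun i => x i l)
        = ∏ l ∈ Finset.univ.erase j, (f l) (fun i => x i l) := fun c =>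
      Finset.prod_congr rfl fun l hl => by
        rw [Function.update_of_ne (Finset.ne_of_mem_erase hl)]
    simp only [he, Function.update_self, hx]
    ring
  map_update_smul' := by
    intro _ f j c a
    rw [← MemLp.toLp_const_smul, MemLp.toLp_eq_toLp_iff]
    have hs : ∀ᵐ x : Fin n → Fin k → ℝ, (c • a) (fun i => x i j) = c * a (fun i => x i j) :=
      (quasiMeasurePreserving_column n j).ae_eq_comp (Lp.coeFn_smul c a)
    filter_upwards [hs] with x hx
    simp only [Pi.smul_apply]
    rw [← Finset.mul_prod_erase _ _ (Finset.mem_univ j),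
      ← Finset.mul_prod_erase _ (fun l => (Function.update f j a l) _) (Finset.mem_univ j)]
    have he : ∀ c : Modes n, ∏ l ∈ Finset.univ.erase j, (Function.update f j c l) (fun i => x i l)
        = ∏ l ∈ Finset.univ.erase j, (f l) (fun i => x i l) := fun c =>
      Finset.prod_congr rfl fun l hl => by
        rw [Function.update_of_ne (Finset.ne_of_mem_erase hl)]
    simp only [he, Function.update_self, hx, smul_eq_mul]
    ring

theorem tensor_const {n : ℕ} (k : ℕ) (ψ : Modes n) : tensor n k (fun _ => ψ) = tensorPow k ψ := rfl

theorem coeFn_tensor {n k : ℕ} {f : Fin k → Modes n} {g : Fin k → (Fin n → ℝ) → ℂ}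
    (h : ∀ j, f j =ᵐ[volume] g j) :
    tensor n k f =ᵐ[volume] fun x => ∏ j, g j (fun i => x i j) :=
  (MemLp.coeFn_toLp (memLp_tensor f)).trans (tensor_ae_congr h)

theorem inner_tensor {n k : ℕ} (f g : Fin k → Modes n) :
    ⟪tensor n k f, tensor n k g⟫_ℂ = ∏ j, ⟪f j, g j⟫_ℂ := by
  simp only [L2.inner_def]
  have h1 : ∀ᵐ x, ⟪tensor n k f x, tensor n k g x⟫_ℂ =
      ∏ j, ⟪f j (fun i => x i j), g j (fun i => x i j)⟫_ℂ := by
    filter_upwards [coeFn_tensor (fun j => Filter.EventuallyEq.rfl (f := f j)),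
      coeFn_tensor (fun j => Filter.EventuallyEq.rfl (f := g j))] with x hf hg
    rw [hf, hg]
    simp only [RCLike.inner_apply, map_prod, Finset.prod_mul_distrib]
  rw [integral_congr_ae h1]
  have h2 := integral_fintype_prod_volume_eq_prod (ι := Fin k)
    (fun j (y : Fin n → ℝ) => ⟪f j y, g j y⟫_ℂ)
  have h3 := integral_map (μ := volume) (measurePreserving_transpose n k).measurable.aemeasurable
    (f := fun y : Fin k → Fin n → ℝ => ∏ j, ⟪f j (y j), g j (y j)⟫_ℂ) (by
      rw [(measurePreserving_transpose n k).map_eq]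
      exact Finset.aestronglyMeasurable_fun_prod _ fun j _ =>
        ((Lp.aestronglyMeasurable (f j)).inner
          (Lp.aestronglyMeasurable (g j))).comp_quasiMeasurePreserving
          (Measure.quasiMeasurePreserving_eval _ j))
  rw [(measurePreserving_transpose n k).map_eq] at h3
  rw [← h2, h3]

theorem norm_tensor {n k : ℕ} (f : Fin k → Modes n) : ‖tensor n k f‖ = ∏ j, ‖f j‖ := by
  have h := inner_tensor f f
  simp only [inner_self_eq_norm_sq_to_K] at h
  rw [Finset.prod_pow, ← RCLike.ofReal_prod, ← RCLike.ofReal_pow, ← RCLike.ofReal_pow] at h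
  have h2 : ‖tensor n k f‖ ^ 2 = (∏ j, ‖f j‖) ^ 2 := RCLike.ofReal_injective h
  exact (pow_left_inj₀ (norm_nonneg _) (Finset.prod_nonneg fun j _ => norm_nonneg _) two_ne_zero).1 h2

theorem coeFn_rotate_tensor {n k : ℕ} (o : Matrix.orthogonalGroup (Fin k) ℝ) {f : Fin k → Modes n}
    {g : Fin k → (Fin n → ℝ) → ℂ} (h : ∀ j, f j =ᵐ[volume] g j) :
    rotate n o (tensor n k f) =ᵐ[volume] fun x => ∏ j, g j
      (fun i => Matrix.vecMul (x i) (o : Matrix (Fin k) (Fin k) ℝ) j) := by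
  refine (Lp.coeFn_compMeasurePreserving (tensor n k f) (measurePreserving_mul n o)).trans ?_
  exact (measurePreserving_mul n o).quasiMeasurePreserving.ae_eq_comp (coeFn_tensor h)

/-! ### Expansion of a tensor power around a product state -/

/-- The sum over the `k` slots of the product vectors with `χ` in that slot and `φ` in all other
slots. -/
def slotSum {n : ℕ} (k : ℕ) (φ : Modes n) : Modes n →ₗ[ℂ] Copies n k :=
  ∑ j, (tensor n k).toLinearMap (fun _ => φ) j

theorem slotSum_apply {n : ℕ} (k : ℕ) (φ χ : Modes n) :
    slotSum k φ χ = ∑ j, tensor n k (Function.update (fun _ => φ) j χ) := by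
  simp [slotSum]

theorem norm_slotSum_le {n : ℕ} (k : ℕ) {φ : Modes n} (hφ : ‖φ‖ = 1) (χ : Modes n) :
    ‖slotSum k φ χ‖ ≤ k * ‖χ‖ := by
  rw [slotSum_apply]
  refine (norm_sum_le _ _).trans ?_
  have : ∀ j : Fin k, ‖tensor n k (Function.update (fun _ => φ) j χ)‖ = ‖χ‖ := fun j => by
    rw [norm_tensor, ← Finset.mul_prod_erase _ _ (Finset.mem_univ j), Function.update_self,
      Finset.prod_congr rfl (g := fun _ => (1 : ℝ)) fun l hl => by
        rw [Function.update_of_ne (Finset.ne_of_mem_erase hl), hφ]]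
    simp
  simp [this]

/-- Terms with χ in different slots are orthogonal because ⟨φ,χ⟩ = 0. -/
theorem norm_sq_slotSum {n : ℕ} (k : ℕ) {φ χ : Modes n} (hφ : ‖φ‖ = 1) (hχ : ⟪φ, χ⟫_ℂ = 0) :
    ‖slotSum k φ χ‖ ^ 2 = k * ‖χ‖ ^ 2 := by
  have h : ⟪slotSum k φ χ, slotSum k φ χ⟫_ℂ = ((k * ‖χ‖ ^ 2 : ℝ) : ℂ) := by
    rw [slotSum_apply, sum_inner]
    have : ∀ j : Fin k, ⟪tensor n k (Function.update (fun _ => φ) j χ),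
        ∑ l, tensor n k (Function.update (fun _ => φ) l χ)⟫_ℂ = ((‖χ‖ ^ 2 : ℝ) : ℂ) := fun j => by
      rw [inner_sum, Finset.sum_eq_single j]
      · rw [inner_self_eq_norm_sq_to_K, norm_tensor,
          ← Finset.mul_prod_erase _ _ (Finset.mem_univ j), Function.update_self,
          Finset.prod_congr rfl (g := fun _ => (1 : ℝ)) fun l hl => by
            rw [Function.update_of_ne (Finset.ne_of_mem_erase hl), hφ]]
        simp
      · intro l _ hl
        rw [inner_tensor]
        refine Finset.prod_eq_zero (Finset.mem_univ l) ?_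
        rw [Function.update_self, Function.update_of_ne hl, hχ]
      · simp
    rw [Finset.sum_congr rfl fun j _ => this j]
    simp
  rw [inner_self_eq_norm_sq_to_K, ← RCLike.ofReal_pow] at h
  exact RCLike.ofReal_injective h

/-- The tensor power of `α φ + χ` up to second order in `χ`. -/
theorem norm_tensorPow_sub_le {n : ℕ} (k : ℕ) {φ χ : Modes n} {α : ℂ} (hφ : ‖φ‖ = 1)
    (hα : ‖α‖ ≤ 1) (hχ : ‖χ‖ ≤ 1) :
    ‖tensorPow k (χ + α • φ) - (α ^ k • tensorPow k φ + α ^ (k - 1) • slotSum k φ χ)‖ ≤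
      2 ^ k * ‖χ‖ ^ 2 := by
  -- `T s` carries χ in the slots of s and αφ elsewhere. Sizes 0 and 1 are the main terms; each of
  -- the others, at most 2^k in number, has norm at most ‖χ‖².
  set T : Finset (Fin k) → Copies n k :=
    fun s => tensor n k (s.piecewise (fun _ => χ) (fun _ => α • φ)) with hT
  have hexp : tensorPow k (χ + α • φ) = ∑ s, T s := by
    rw [← tensor_const, ← (tensor n k).map_add_univ]
    rfl
  have h0 : T ∅ = α ^ k • tensorPow k φ := by
    rw [hT, ← tensor_const]
    simp only [Finset.piecewise_empty]
    rw [(tensor n k).map_smul_univ (fun _ => α) (fun _ => φ)]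
    simp
  have h1 : ∀ j, T {j} = α ^ (k - 1) • tensor n k (Function.update (fun _ => φ) j χ) := fun j => by
    have e : ({j} : Finset (Fin k)).piecewise (fun _ => χ) (fun _ => α • φ) =
        ({j}ᶜ : Finset (Fin k)).piecewise
          (fun i => α • Function.update (fun _ => φ) j χ i) (Function.update (fun _ => φ) j χ) := by
      ext1 i
      by_cases hi : i = j
      · subst hi; simp
      · simp [hi]
    rw [hT]
    simp only [e]
    rw [(tensor n k).map_piecewise_smul (fun _ => α)]
    simp [Finset.card_compl]
  have h2 : ∀ s : Finset (Fin k), 2 ≤ s.card → ‖T s‖ ≤ ‖χ‖ ^ 2 := fun s hs => by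
    have hle : ‖T s‖ ≤ ∏ j, (s.piecewise (fun _ => ‖χ‖) (fun _ => 1)) j := by
      rw [hT, norm_tensor]
      refine Finset.prod_le_prod (fun _ _ => norm_nonneg _) fun j _ => ?_
      by_cases hj : j ∈ s
      · simp [hj]
      · simpa [hj, norm_smul, hφ] using hα
    rw [Finset.prod_piecewise] at hle
    simp only [Finset.prod_const, Finset.univ_inter, one_pow, mul_one] at hle
    exact hle.trans (pow_le_pow_of_le_one (norm_nonneg _) hχ hs)
  have hsplit : ∑ s, T s - (α ^ k • tensorPow k φ + α ^ (k - 1) • slotSum k φ χ) =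
      ∑ s with 2 ≤ s.card, T s := by
    have hs1 : α ^ (k - 1) • slotSum k φ χ = ∑ s with s.card = 1, T s := by
      rw [slotSum_apply, Finset.smul_sum, Finset.univ_filter_card_eq, Finset.powersetCard_one,
        Finset.sum_map]
      exact Finset.sum_congr rfl fun j _ => (h1 j).symm
    have hs0 : α ^ k • tensorPow k φ = ∑ s with s.card = 0, T s := by
      rw [Finset.univ_filter_card_eq, Finset.powersetCard_zero, Finset.sum_singleton, h0]
    rw [hs0, hs1, sub_eq_iff_eq_add]
    simp only [Finset.sum_filter]
    rw [← Finset.sum_add_distrib, ← Finset.sum_add_distrib]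
    refine Finset.sum_congr rfl fun s _ => ?_
    rcases lt_trichotomy s.card 1 with h | h | h
    · have : s.card = 0 := by omega
      simp [this]
    · simp [h]
    · have h' : 2 ≤ s.card := h
      simp [h', show s.card ≠ 1 by omega, show s ≠ ∅ by rintro rfl; simp at h]
  rw [hexp, hsplit]
  refine (norm_sum_le _ _).trans ((Finset.sum_le_card_nsmul _ _ (‖χ‖ ^ 2) fun s hs =>
    h2 s (Finset.mem_filter.1 hs).2).trans ?_)
  rw [nsmul_eq_mul]
  refine mul_le_mul_of_nonneg_right ?_ (by positivity)
  have := Finset.card_filter_le (Finset.univ : Finset (Finset (Fin k))) (fun s => 2 ≤ s.card)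
  rw [Finset.card_univ, Fintype.card_finset, Fintype.card_fin] at this
  exact_mod_cast this

/-! ### The vacuum and vectors obtained by multiplying it -/

/-- The squared Euclidean norm. -/
def sqNorm {n : ℕ} (u : Fin n → ℝ) : ℝ := ∑ i, u i ^ 2

theorem sqNorm_nonneg {n : ℕ} (u : Fin n → ℝ) : 0 ≤ sqNorm u :=
  Finset.sum_nonneg fun i _ => sq_nonneg (u i)

theorem sq_le_sqNorm {n : ℕ} (u : Fin n → ℝ) (i : Fin n) : u i ^ 2 ≤ sqNorm u :=
  Finset.single_le_sum (f := fun i => u i ^ 2) (fun i _ => sq_nonneg (u i)) (Finset.mem_univ i)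

theorem continuous_sqNorm (n : ℕ) : Continuous (sqNorm : (Fin n → ℝ) → ℝ) := by
  unfold sqNorm; fun_prop

/-- The Gaussian probability density `π^(-n/2) exp (-|u|²)` times `exp (c · u)`. -/
def gaussExp {n : ℕ} (c : Fin n → ℂ) (u : Fin n → ℝ) : ℂ :=
  ((Real.pi ^ (-(n : ℝ) / 2) : ℝ) : ℂ) * Complex.exp (-∑ i, (u i : ℂ) ^ 2 + ∑ i, c i * u i)

/-- The wavefunction `π^(-n/4) exp (-|u|²/2)` of the vacuum. -/
def vac {n : ℕ} (u : Fin n → ℝ) : ℂ :=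
  ((Real.pi ^ (-(n : ℝ) / 4) * Real.exp (-sqNorm u / 2) : ℝ) : ℂ)

theorem vac_ne_zero {n : ℕ} (u : Fin n → ℝ) : vac u ≠ 0 := by
  rw [vac, Complex.ofReal_ne_zero]
  positivity

theorem conj_vac {n : ℕ} (u : Fin n → ℝ) : conj (vac u) = vac u := Complex.conj_ofReal _

theorem vac_mul_vac {n : ℕ} (c : Fin n → ℂ) (u : Fin n → ℝ) :
    vac u * vac u * Complex.exp (∑ i, c i * u i) = gaussExp c u := by
  have h : vac u * vac u =
      ((Real.pi ^ (-(n : ℝ) / 2) : ℝ) : ℂ) * Complex.exp (-∑ i, (u i : ℂ) ^ 2) := by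
    have e : -(n : ℝ) / 4 + -(n : ℝ) / 4 = -(n : ℝ) / 2 := by ring
    have e' : -sqNorm u / 2 + -sqNorm u / 2 = -sqNorm u := by ring
    rw [vac, ← Complex.ofReal_mul, mul_mul_mul_comm, ← Real.rpow_add Real.pi_pos, ← Real.exp_add,
      Complex.ofReal_mul, Complex.ofReal_exp, e, e', sqNorm]
    push_cast
    rfl
  rw [h, gaussExp, Complex.exp_add, mul_assoc]

theorem continuous_vac (n : ℕ) : Continuous (vac : (Fin n → ℝ) → ℂ) := by
  have := continuous_sqNorm n
  unfold vac; fun_prop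

theorem integral_gaussExp {n : ℕ} (c : Fin n → ℂ) :
    ∫ u, gaussExp c u = Complex.exp ((∑ i, c i ^ 2) / 4) := by
  have h := GaussianFourier.integral_cexp_neg_mul_sum_add (b := 1) (by simp) c
  simp only [gaussExp, integral_const_mul]
  simp only [neg_mul, one_mul, div_one, mul_one, Fintype.card_fin] at h
  rw [h, ← mul_assoc, Complex.ofReal_cpow Real.pi_pos.le, ← Complex.cpow_add _ _
    (by exact_mod_cast Real.pi_ne_zero)]
  push_cast
  rw [show -(n : ℂ) / 2 + n / 2 = 0 by ring]
  simp

theorem integrable_exp_neg_sqNorm (n : ℕ) {b : ℝ} (hb : 0 < b) :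
    Integrable (fun u : Fin n → ℝ => Real.exp (-b * sqNorm u)) := by
  have h := Integrable.fintype_prod (ι := Fin n) (μ := fun _ => (volume : Measure ℝ))
    (f := fun _ x => Real.exp (-b * x ^ 2)) (fun _ => integrable_exp_neg_mul_sq hb)
  simp only [← Real.exp_sum, ← Finset.mul_sum] at h
  exact h

/-- `f` grows slower than `exp (|u|²/4)`. -/
def SlowGrowth {n : ℕ} (f : (Fin n → ℝ) → ℂ) : Prop :=
  Continuous f ∧ ∃ C : ℝ, ∀ u, ‖f u‖ ≤ C * Real.exp (sqNorm u / 4)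

/-- The squared modulus is at most a constant times exp(−|u|²/2). The rate 1/4 also leaves room for
quadratic polynomials and for the exponentials of `slowGrowth_exp_mul`. -/
theorem SlowGrowth.memLp {n : ℕ} {f : (Fin n → ℝ) → ℂ} (hf : SlowGrowth f) :
    MemLp (fun u => vac u * f u) 2 volume := by
  obtain ⟨hc, C, hC⟩ := hf
  have hm : Continuous fun u => vac u * f u := (continuous_vac n).mul hc
  rw [memLp_two_iff_integrable_sq_norm hm.aestronglyMeasurable]
  refine ((integrable_exp_neg_sqNorm n (b := 1 / 2) (by norm_num)).const_mul
    ((Real.pi ^ (-(n : ℝ) / 4) * C) ^ 2)).mono' (hm.norm.pow 2).aestronglyMeasurable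
    (Filter.Eventually.of_forall fun u => ?_)
  rw [Real.norm_of_nonneg (by positivity), norm_mul, vac, Complex.norm_real,
    Real.norm_of_nonneg (by positivity)]
  calc (Real.pi ^ (-(n : ℝ) / 4) * Real.exp (-sqNorm u / 2) * ‖f u‖) ^ 2
      ≤ (Real.pi ^ (-(n : ℝ) / 4) * Real.exp (-sqNorm u / 2) * (C * Real.exp (sqNorm u / 4))) ^ 2 := by
        gcongr; exact hC u
    _ = (Real.pi ^ (-(n : ℝ) / 4) * C) ^ 2 *
        (Real.exp (-sqNorm u / 2) * Real.exp (sqNorm u / 4)) ^ 2 := by ring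
    _ = _ := by
        rw [← Real.exp_add, ← Real.exp_nat_mul]
        congr 2
        push_cast
        ring

theorem SlowGrowth.add {n : ℕ} {f g : (Fin n → ℝ) → ℂ} (hf : SlowGrowth f) (hg : SlowGrowth g) :
    SlowGrowth (fun u => f u + g u) := by
  obtain ⟨hc, C, hC⟩ := hf
  obtain ⟨hc', C', hC'⟩ := hg
  refine ⟨hc.add hc', C + C', fun u => (norm_add_le _ _).trans ?_⟩
  rw [add_mul]
  exact add_le_add (hC u) (hC' u)

theorem SlowGrowth.const_mul {n : ℕ} {f : (Fin n → ℝ) → ℂ} (hf : SlowGrowth f) (c : ℂ) :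
    SlowGrowth (fun u => c * f u) := by
  obtain ⟨hc, C, hC⟩ := hf
  refine ⟨continuous_const.mul hc, ‖c‖ * C, fun u => ?_⟩
  rw [norm_mul, mul_assoc]
  exact mul_le_mul_of_nonneg_left (hC u) (norm_nonneg _)

theorem SlowGrowth.of_le {n : ℕ} {f : (Fin n → ℝ) → ℂ} (hf : Continuous f) {C : ℝ}
    (h : ∀ u, ‖f u‖ ≤ C * (1 + sqNorm u)) : SlowGrowth f := by
  have hC : 0 ≤ C := by
    have := (norm_nonneg _).trans (h 0)
    simpa [sqNorm] using this
  refine ⟨hf, C * 4, fun u => (h u).trans ?_⟩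
  rw [mul_assoc]
  refine mul_le_mul_of_nonneg_left ?_ hC
  have := Real.add_one_le_exp (sqNorm u / 4)
  have := sqNorm_nonneg u
  linarith

theorem slowGrowth_one (n : ℕ) : SlowGrowth (fun _ : Fin n → ℝ => 1) :=
  .of_le continuous_const (C := 1) fun u => by simp [sqNorm_nonneg]

theorem norm_coord_le {n : ℕ} (u : Fin n → ℝ) (k : Fin n) : ‖(u k : ℂ)‖ ≤ 1 + sqNorm u := by
  rw [Complex.norm_real, Real.norm_eq_abs]
  have := sq_le_sqNorm u k
  have := sq_abs (u k)
  nlinarith [sq_nonneg (|u k| - 1), abs_nonneg (u k)]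

theorem norm_coord_mul_coord_le {n : ℕ} (u : Fin n → ℝ) (k l : Fin n) :
    ‖(u k * u l : ℂ)‖ ≤ sqNorm u := by
  rw [norm_mul, Complex.norm_real, Complex.norm_real, Real.norm_eq_abs, Real.norm_eq_abs]
  have := sq_le_sqNorm u k
  have := sq_le_sqNorm u l
  have := sq_abs (u k)
  have := sq_abs (u l)
  nlinarith [sq_nonneg (|u k| - |u l|)]

theorem slowGrowth_coord {n : ℕ} (k : Fin n) : SlowGrowth (fun u : Fin n → ℝ => (u k : ℂ)) :=
  .of_le (by fun_prop) (C := 1) fun u => by simpa using norm_coord_le u k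

theorem slowGrowth_coord_mul_coord {n : ℕ} (k l : Fin n) :
    SlowGrowth (fun u : Fin n → ℝ => (u k * u l : ℂ)) :=
  .of_le (by fun_prop) (C := 1) fun u => by
    have := norm_coord_mul_coord_le u k l
    linarith

theorem slowGrowth_exp {n : ℕ} (c : Fin n → ℂ) :
    SlowGrowth (fun u : Fin n → ℝ => Complex.exp (∑ i, c i * u i)) := by
  refine ⟨by fun_prop, Real.exp (∑ i, ‖c i‖ ^ 2), fun u => ?_⟩
  rw [Complex.norm_exp, ← Real.exp_add, Real.exp_le_exp]
  refine (Complex.re_le_norm _).trans ((norm_sum_le _ _).trans ?_)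
  rw [sqNorm, Finset.sum_div, ← Finset.sum_add_distrib]
  refine Finset.sum_le_sum fun i _ => ?_
  rw [norm_mul, Complex.norm_real, Real.norm_eq_abs]
  nlinarith [sq_nonneg (‖c i‖ - |u i| / 2), sq_abs (u i)]

open Classical in
/-- The vector with wavefunction `vac · f` (zero if this is not square integrable). -/
def vacMul {n : ℕ} (f : (Fin n → ℝ) → ℂ) : Modes n :=
  if h : MemLp (fun u => vac u * f u) 2 volume then h.toLp _ else 0

theorem SlowGrowth.coeFn_vacMul {n : ℕ} {f : (Fin n → ℝ) → ℂ} (hf : SlowGrowth f) :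
    vacMul f =ᵐ[volume] fun u => vac u * f u := by
  rw [vacMul, dif_pos hf.memLp]
  exact MemLp.coeFn_toLp _

theorem vacMul_add {n : ℕ} {f g : (Fin n → ℝ) → ℂ} (hf : SlowGrowth f) (hg : SlowGrowth g) :
    vacMul (fun u => f u + g u) = vacMul f + vacMul g := by
  apply Lp.ext
  filter_upwards [hf.coeFn_vacMul, hg.coeFn_vacMul, (hf.add hg).coeFn_vacMul,
    Lp.coeFn_add (vacMul f) (vacMul g)] with u h1 h2 h3 h4
  rw [h3, h4, Pi.add_apply, h1, h2, mul_add]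

theorem vacMul_const_mul {n : ℕ} {f : (Fin n → ℝ) → ℂ} (hf : SlowGrowth f) (c : ℂ) :
    vacMul (fun u => c * f u) = c • vacMul f := by
  apply Lp.ext
  filter_upwards [hf.coeFn_vacMul, (hf.const_mul c).coeFn_vacMul,
    Lp.coeFn_smul c (vacMul f)] with u h1 h2 h3
  rw [h3, h2, Pi.smul_apply, h1, smul_eq_mul, mul_left_comm]

theorem inner_vacMul {n : ℕ} {f g : (Fin n → ℝ) → ℂ} (hf : SlowGrowth f) (hg : SlowGrowth g) :
    ⟪vacMul f, vacMul g⟫_ℂ = ∫ u, vac u * vac u * (conj (f u) * g u) := by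
  rw [L2.inner_def]
  refine integral_congr_ae ?_
  filter_upwards [hf.coeFn_vacMul, hg.coeFn_vacMul] with u h1 h2
  rw [h1, h2, RCLike.inner_apply, map_mul, conj_vac]
  ring

theorem SlowGrowth.integrable_mul {n : ℕ} {f g : (Fin n → ℝ) → ℂ} (hf : SlowGrowth f)
    (hg : SlowGrowth g) : Integrable (fun u => vac u * vac u * (f u * g u)) := by
  have := hf.memLp.integrable_mul hg.memLp
  refine this.congr (Filter.Eventually.of_forall fun u => ?_)
  simp only [Pi.mul_apply]
  ring

/-- K is the norm of the vacuum times the envelope exp(|u|²/4). It depends on n alone, which makes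
the remainder bounds uniform over all Gaussian states. -/
theorem exists_norm_vacMul_le (n : ℕ) : ∃ K : ℝ, 0 ≤ K ∧ ∀ (f : (Fin n → ℝ) → ℂ) (C : ℝ),
    Continuous f → (∀ u, ‖f u‖ ≤ C * Real.exp (sqNorm u / 4)) → ‖vacMul f‖ ≤ C * K := by
  have hg : SlowGrowth (fun u : Fin n → ℝ => ((Real.exp (sqNorm u / 4) : ℝ) : ℂ)) := by
    have := continuous_sqNorm n
    exact ⟨by fun_prop, 1, fun u => by simp [Complex.norm_exp]⟩
  refine ⟨‖vacMul (fun u : Fin n → ℝ => ((Real.exp (sqNorm u / 4) : ℝ) : ℂ))‖, norm_nonneg _,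
    fun f C hf h => ?_⟩
  have hf' : SlowGrowth f := ⟨hf, C, h⟩
  refine Lp.norm_le_mul_norm_of_ae_le_mul ?_
  filter_upwards [hf'.coeFn_vacMul, hg.coeFn_vacMul] with u h1 h2
  rw [h1, h2, norm_mul, norm_mul, mul_left_comm, Complex.norm_real, Real.norm_of_nonneg (by positivity)]
  exact mul_le_mul_of_nonneg_left (h u) (norm_nonneg _)

/-! ### Gaussian moments -/

/-- Integration by parts against the constant 1; the source of the moment recursions. -/
theorem integral_eq_zero_of_hasLineDerivAt {n : ℕ} {G G' : (Fin n → ℝ) → ℂ} {v : Fin n → ℝ}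
    (hG : Integrable G) (hG' : Integrable G') (h : ∀ x, HasLineDerivAt ℝ G (G' x) x v) :
    ∫ x, G' x = 0 := by
  have := integral_bilinear_hasLineDerivAt_right_eq_neg_left_of_integrable
    (μ := volume) (f := fun _ => (1 : ℂ)) (f' := fun _ => 0) (g := G) (g' := G') (v := v)
    (B := ContinuousLinearMap.mul ℝ ℂ) (by simp) (by simpa using hG') (by simpa using hG)
    (fun x _ => by simpa [HasLineDerivAt] using hasDerivAt_const (0 : ℝ) (1 : ℂ))
    (fun x _ => h x)
  simpa using this

theorem hasLineDerivAt_coord {n : ℕ} (k l : Fin n) (u : Fin n → ℝ) :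
    HasLineDerivAt ℝ (fun u : Fin n → ℝ => (u l : ℂ)) (if l = k then 1 else 0) u
      (Pi.single k 1) := by
  have h : HasDerivAt (fun t : ℝ => u l + t * (Pi.single k 1 : Fin n → ℝ) l)
      ((Pi.single k 1 : Fin n → ℝ) l) 0 := by
    simpa using ((hasDerivAt_id (0 : ℝ)).mul_const ((Pi.single k 1 : Fin n → ℝ) l)).const_add (u l)
  have := h.ofReal_comp
  simp only [HasLineDerivAt]
  convert! this using 1
  simp [Pi.single_apply, apply_ite]

theorem hasLineDerivAt_gaussExp {n : ℕ} (c : Fin n → ℂ) (k : Fin n) (u : Fin n → ℝ) :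
    HasLineDerivAt ℝ (gaussExp c) ((c k - 2 * u k) * gaussExp c u) u (Pi.single k 1) := by
  have hc : ∀ l, HasDerivAt (fun t : ℝ => ((u + t • (Pi.single k 1 : Fin n → ℝ)) l : ℂ))
      (if l = k then 1 else 0) 0 := fun l => hasLineDerivAt_coord k l u
  have h1 := (HasDerivAt.fun_sum (u := Finset.univ) fun l _ => (hc l).fun_pow 2).fun_neg.fun_add
    (HasDerivAt.fun_sum (u := Finset.univ) fun l _ => (hc l).const_mul (c l))
  have h2 := (h1.cexp).const_mul ((Real.pi ^ (-(n : ℝ) / 2) : ℝ) : ℂ)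
  simp only [HasLineDerivAt]
  convert! h2 using 1
  simp [gaussExp]
  ring

theorem integrable_gaussExp_mul {n : ℕ} (c : Fin n → ℂ) {f : (Fin n → ℝ) → ℂ}
    (hf : SlowGrowth f) : Integrable (fun u => f u * gaussExp c u) := by
  refine (hf.integrable_mul (slowGrowth_exp c)).congr (Filter.Eventually.of_forall fun u => ?_)
  simp only [← vac_mul_vac]
  ring

theorem integral_coord_mul_gaussExp {n : ℕ} (c : Fin n → ℂ) (k : Fin n) :
    ∫ u, (u k : ℂ) * gaussExp c u = c k / 2 * Complex.exp ((∑ i, c i ^ 2) / 4) := by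
  have i0 := integrable_gaussExp_mul c (slowGrowth_one n)
  have i1 := integrable_gaussExp_mul c (slowGrowth_coord k)
  simp only [one_mul] at i0
  have e : ∀ u, (c k - 2 * u k) * gaussExp c u =
      c k * gaussExp c u - 2 * ((u k : ℂ) * gaussExp c u) := fun u => by ring
  have h := integral_eq_zero_of_hasLineDerivAt i0
    (by simp only [e]; exact (i0.const_mul _).sub (i1.const_mul _)) (hasLineDerivAt_gaussExp c k)
  simp only [e] at h
  rw [integral_sub (i0.const_mul _) (i1.const_mul _), integral_const_mul, integral_const_mul,
    integral_gaussExp] at h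
  linear_combination (-1 / 2 : ℂ) * h

/-- The integral of ∂_k(u_l · `gaussExp c`) vanishes; the Kronecker term is the derivative of u_l.
-/
theorem integral_coord_mul_coord_mul_gaussExp {n : ℕ} (c : Fin n → ℂ) (k l : Fin n) :
    ∫ u, (u k * u l : ℂ) * gaussExp c u =
      ((if l = k then 1 / 2 else 0) + c k * c l / 4) * Complex.exp ((∑ i, c i ^ 2) / 4) := by
  have i0 := integrable_gaussExp_mul c (slowGrowth_one n)
  have i1 := integrable_gaussExp_mul c (slowGrowth_coord l)
  have i2 := integrable_gaussExp_mul c (slowGrowth_coord_mul_coord k l)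
  simp only [one_mul] at i0
  have e : ∀ u : Fin n → ℝ, (u l : ℂ) * ((c k - 2 * u k) * gaussExp c u) +
      (if l = k then 1 else 0) * gaussExp c u =
      (c k * ((u l : ℂ) * gaussExp c u) - 2 * ((u k * u l : ℂ) * gaussExp c u)) +
      (if l = k then 1 else 0) * gaussExp c u := fun u => by ring
  have hi : Integrable fun u : Fin n → ℝ => c k * ((u l : ℂ) * gaussExp c u) -
      2 * ((u k * u l : ℂ) * gaussExp c u) := (i1.const_mul (c k)).sub (i2.const_mul 2)
  have hi0 := i0.const_mul (if l = k then 1 else 0)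
  have h := integral_eq_zero_of_hasLineDerivAt i1 (G' := fun u => (u l : ℂ) *
      ((c k - 2 * u k) * gaussExp c u) + (if l = k then 1 else 0) * gaussExp c u)
    (by simp only [e]; exact hi.add hi0)
    (fun u => by
      have := (hasLineDerivAt_coord k l u).fun_mul (hasLineDerivAt_gaussExp c k u)
      simp only [HasLineDerivAt] at this ⊢
      convert! this using 1
      simp
      ring)
  simp only [e] at h
  rw [integral_add hi hi0, integral_sub (i1.const_mul _) (i2.const_mul _), integral_const_mul,
    integral_const_mul, integral_const_mul, integral_gaussExp, integral_coord_mul_gaussExp] at h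
  split_ifs at h ⊢
  · linear_combination (-1 / 2 : ℂ) * h
  · linear_combination (-1 / 2 : ℂ) * h

/-! ### Unnormalized coherent states and low Hermite functions -/

/-- The exponents of `expFun`. -/
def expCoeff {n : ℕ} (y : Fin n → ℝ) (i : Fin n) : ℂ := Complex.I * √2 * y i

/-- The function by which the vacuum is multiplied in `coherent y`. -/
def expFun {n : ℕ} (y : Fin n → ℝ) (u : Fin n → ℝ) : ℂ :=
  Complex.exp ((∑ i, (y i : ℂ) ^ 2) / 2) * Complex.exp (∑ i, expCoeff y i * u i)

/-- The unnormalized coherent state with purely imaginary displacement `y`. -/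
def coherent {n : ℕ} (y : Fin n → ℝ) : Modes n := vacMul (expFun y)

/-- The Hermite functions of degree one. -/
def hermiteOne {n : ℕ} (k : Fin n) : Modes n := vacMul fun u => (√2 : ℂ) * u k

/-- The (unnormalized) Hermite functions of degree two. -/
def hermiteTwo {n : ℕ} (k l : Fin n) : Modes n :=
  vacMul fun u => 2 * (u k * u l) + (if l = k then -1 else 0) * 1

theorem slowGrowth_expFun {n : ℕ} (y : Fin n → ℝ) : SlowGrowth (expFun y) :=
  (slowGrowth_exp _).const_mul _

theorem sqrt_two_sq : (√2 : ℂ) ^ 2 = 2 := by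
  rw [← Complex.ofReal_pow, Real.sq_sqrt (by norm_num)]
  norm_num

theorem sum_expCoeff_sq {n : ℕ} (y : Fin n → ℝ) :
    ∑ i, expCoeff y i ^ 2 = -2 * ∑ i, (y i : ℂ) ^ 2 := by
  rw [Finset.mul_sum]
  refine Finset.sum_congr rfl fun i _ => ?_
  rw [expCoeff, mul_pow, mul_pow, sqrt_two_sq, Complex.I_sq]
  ring

theorem vac_mul_vac_mul_expFun {n : ℕ} (y u : Fin n → ℝ) :
    vac u * vac u * expFun y u =
      Complex.exp ((∑ i, (y i : ℂ) ^ 2) / 2) * gaussExp (expCoeff y) u := by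
  rw [← vac_mul_vac, expFun]
  ring

theorem exp_mul_exp_expCoeff {n : ℕ} (y : Fin n → ℝ) :
    Complex.exp ((∑ i, (y i : ℂ) ^ 2) / 2) * Complex.exp ((∑ i, expCoeff y i ^ 2) / 4) = 1 := by
  rw [← Complex.exp_add, sum_expCoeff_sq, ← Complex.exp_zero]
  congr 1
  ring

/-- The prefactor exp(|y|²/2) is chosen so that exactly exp(y·y') remains, whose term of order m is
the kernel of Hermite degree m. Imaginary displacements form a Fourier family, so real parameters y
will suffice for totality. -/
theorem inner_coherent {n : ℕ} (y y' : Fin n → ℝ) :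
    ⟪coherent y, coherent y'⟫_ℂ = Complex.exp (∑ i, (y i : ℂ) * y' i) := by
  rw [coherent, coherent, inner_vacMul (slowGrowth_expFun y) (slowGrowth_expFun y')]
  have e : ∀ u, vac u * vac u * (conj (expFun y u) * expFun y' u) =
      (Complex.exp ((∑ i, (y i : ℂ) ^ 2) / 2) * Complex.exp ((∑ i, (y' i : ℂ) ^ 2) / 2)) *
        gaussExp (expCoeff (y' - y)) u := fun u => by
    rw [← vac_mul_vac]
    have : conj (expFun y u) = Complex.exp ((∑ i, (y i : ℂ) ^ 2) / 2) *
        Complex.exp (∑ i, -expCoeff y i * u i) := by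
      rw [expFun, map_mul, ← Complex.exp_conj, ← Complex.exp_conj]
      simp [expCoeff, map_sum, Complex.conj_ofNat]
    have h2 : Complex.exp (∑ i, expCoeff (y' - y) i * u i) =
        Complex.exp (∑ i, -expCoeff y i * u i) * Complex.exp (∑ i, expCoeff y' i * u i) := by
      rw [← Complex.exp_add, ← Finset.sum_add_distrib]
      congr 1
      refine Finset.sum_congr rfl fun i _ => ?_
      simp only [expCoeff, Pi.sub_apply, Complex.ofReal_sub]
      ring
    rw [this, expFun, h2]
    ring
  simp only [e]
  rw [integral_const_mul, integral_gaussExp, sum_expCoeff_sq, ← Complex.exp_add, ← Complex.exp_add]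
  congr 1
  have : ∑ i, (((y' - y) i : ℝ) : ℂ) ^ 2 =
      ∑ i, (y' i : ℂ) ^ 2 + ∑ i, (y i : ℂ) ^ 2 - 2 * ∑ i, (y i : ℂ) * y' i := by
    rw [Finset.mul_sum, ← Finset.sum_add_distrib, ← Finset.sum_sub_distrib]
    refine Finset.sum_congr rfl fun i _ => ?_
    simp only [Pi.sub_apply, Complex.ofReal_sub]
    ring
  rw [this]
  ring

theorem coherent_zero (n : ℕ) : coherent (0 : Fin n → ℝ) = vacMul fun _ => 1 := by
  have : expFun (0 : Fin n → ℝ) = fun _ => 1 := by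
    ext1 u
    simp [expFun, expCoeff]
  rw [coherent, this]

theorem norm_coherent_zero (n : ℕ) : ‖coherent (0 : Fin n → ℝ)‖ = 1 := by
  have h := inner_coherent (0 : Fin n → ℝ) 0
  rw [inner_self_eq_norm_sq_to_K] at h
  simp only [Pi.zero_apply, Complex.ofReal_zero, mul_zero, Finset.sum_const_zero,
    Complex.exp_zero, ← RCLike.ofReal_pow] at h
  have h2 : ‖coherent (0 : Fin n → ℝ)‖ ^ 2 = 1 := 
    RCLike.ofReal_injective (K := ℂ) (h.trans RCLike.ofReal_one.symm)
  exact (pow_eq_one_iff_of_nonneg (norm_nonneg _) two_ne_zero).1 h2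

theorem inner_vacMul_coherent {n : ℕ} {f : (Fin n → ℝ) → ℂ} (hf : SlowGrowth f) (y : Fin n → ℝ)
    (hreal : ∀ u, conj (f u) = f u) :
    ⟪vacMul f, coherent y⟫_ℂ = Complex.exp ((∑ i, (y i : ℂ) ^ 2) / 2) *
      ∫ u, f u * gaussExp (expCoeff y) u := by
  rw [coherent, inner_vacMul hf (slowGrowth_expFun y), ← integral_const_mul]
  refine integral_congr_ae (Filter.Eventually.of_forall fun u => ?_)
  simp only [hreal, mul_left_comm _ (f u), vac_mul_vac_mul_expFun]

theorem inner_hermiteOne_coherent {n : ℕ} (k : Fin n) (y : Fin n → ℝ) :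
    ⟪hermiteOne k, coherent y⟫_ℂ = Complex.I * y k := by
  rw [hermiteOne, inner_vacMul_coherent ((slowGrowth_coord k).const_mul _) _ (by simp)]
  simp only [mul_assoc]
  rw [integral_const_mul, integral_coord_mul_gaussExp]
  have h := exp_mul_exp_expCoeff y
  have h2 := sqrt_two_sq
  rw [expCoeff]
  linear_combination (Complex.I * y k) * h + (Complex.I * y k / 2 *
    (Complex.exp ((∑ i, (y i : ℂ) ^ 2) / 2) * Complex.exp ((∑ i, expCoeff y i ^ 2) / 4))) * h2

/-- Subtracting the Kronecker term removes the vacuum component, so the overlap is a pure quadratic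
monomial and reads off degree two. -/
theorem inner_hermiteTwo_coherent {n : ℕ} (k l : Fin n) (y : Fin n → ℝ) :
    ⟪hermiteTwo k l, coherent y⟫_ℂ = -(y k * y l) := by
  have hs := (slowGrowth_coord_mul_coord k l).const_mul 2
  have hs1 := (slowGrowth_one n).const_mul (if l = k then -1 else 0)
  rw [hermiteTwo, inner_vacMul_coherent (hs.add hs1) _ (by
    intro u; split_ifs <;> simp [Complex.conj_ofNat])]
  simp only [add_mul]
  have i2 := integrable_gaussExp_mul (expCoeff y) hs
  have i1 := integrable_gaussExp_mul (expCoeff y) hs1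
  rw [integral_add i2 i1]
  simp only [mul_one, mul_assoc (2 : ℂ)]
  rw [integral_const_mul, integral_const_mul, integral_gaussExp,
    integral_coord_mul_coord_mul_gaussExp]
  have h := exp_mul_exp_expCoeff y
  have hc : expCoeff y k * expCoeff y l = -2 * (y k * y l) := by
    have h2 := sqrt_two_sq
    have h3 := Complex.I_sq
    simp only [expCoeff]
    linear_combination (y k * y l : ℂ) * (√2 : ℂ) ^ 2 * h3 - (y k * y l : ℂ) * h2
  rw [hc]
  split_ifs
  · linear_combination (-(y k * y l) : ℂ) * h
  · linear_combination (-(y k * y l) : ℂ) * h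

/-! ### First-order expansion of `vac · exp (t q)` -/

/-- Taylor's remainder is at most |w|² exp|w| with |w| ≤ t(1+s). The square is absorbed by 1+s ≤ 16
exp((1+s)/16), whence 256 = 16², and the total exponent 3(1+s)/16 stays below (1+s)/4. -/
theorem norm_exp_mul_sub_le {w s t : ℝ} {z : ℂ} (hz : ‖z‖ ≤ 1 + s) (hs : 0 ≤ s) (ht : 0 ≤ t)
    (ht1 : t ≤ 1 / 16) (hw : w = 256 * Real.exp (1 / 4)) :
    ‖Complex.exp (t * z) + (-1) * (1 + t * z)‖ ≤ (w * t ^ 2) * Real.exp (s / 4) := by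
  have h := Complex.norm_exp_sub_sum_le_norm_mul_exp (t * z) 2
  simp only [Finset.sum_range_succ, Finset.sum_range_zero, pow_zero, Nat.factorial, pow_one] at h
  have e : Complex.exp (t * z) + (-1) * (1 + t * z) =
      Complex.exp (t * z) - (0 + 1 / ((1 : ℕ) : ℂ) + t * z / (((0 + 1) * 1 : ℕ) : ℂ)) := by
    push_cast; ring
  rw [e]
  refine h.trans ?_
  have h1 : ‖(t : ℂ) * z‖ ≤ t * (1 + s) := by
    rw [norm_mul, Complex.norm_real, Real.norm_of_nonneg ht]
    gcongr
  have h2 : 1 + s ≤ 16 * Real.exp ((1 + s) / 16) := by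
    have := Real.add_one_le_exp ((1 + s) / 16)
    linarith
  calc ‖(t : ℂ) * z‖ ^ 2 * Real.exp ‖(t : ℂ) * z‖
      ≤ (t * (1 + s)) ^ 2 * Real.exp (1 / 16 * (1 + s)) := by gcongr; exact h1.trans (by gcongr)
    _ ≤ (t * (16 * Real.exp ((1 + s) / 16))) ^ 2 * Real.exp (1 / 16 * (1 + s)) := by gcongr
    _ = 256 * t ^ 2 * (Real.exp ((1 + s) / 16) ^ 2 * Real.exp (1 / 16 * (1 + s))) := by ring
    _ ≤ 256 * t ^ 2 * Real.exp (1 / 4 + s / 4) := by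
        gcongr
        rw [← Real.exp_nat_mul, ← Real.exp_add, Real.exp_le_exp]
        push_cast
        linarith
    _ = _ := by rw [hw, Real.exp_add]; ring

theorem slowGrowth_exp_mul {n : ℕ} {q : (Fin n → ℝ) → ℂ} (hq : Continuous q)
    (hle : ∀ u, ‖q u‖ ≤ 1 + sqNorm u) {t : ℝ} (ht : 0 ≤ t) (ht1 : t ≤ 1 / 16) :
    SlowGrowth (fun u => Complex.exp (t * q u)) := by
  refine ⟨by fun_prop, Real.exp (1 / 16), fun u => ?_⟩
  rw [Complex.norm_exp, ← Real.exp_add, Real.exp_le_exp]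
  refine (Complex.re_le_norm _).trans ?_
  rw [norm_mul, Complex.norm_real, Real.norm_of_nonneg ht]
  have := mul_le_mul ht1 (hle u) (norm_nonneg _) (by norm_num)
  have := sqNorm_nonneg u
  linarith

/-- One C serves all directions q, so a tolerance can be fixed before the Gaussian state is chosen.
-/
theorem exists_norm_vacMul_exp_sub_le (n : ℕ) : ∃ C : ℝ, 0 ≤ C ∧
    ∀ q : (Fin n → ℝ) → ℂ, Continuous q → (∀ u, ‖q u‖ ≤ 1 + sqNorm u) →
      ∀ t : ℝ, 0 ≤ t → t ≤ 1 / 16 →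
      ‖vacMul (fun u => Complex.exp (t * q u)) - (coherent 0 + (t : ℂ) • vacMul q)‖ ≤ C * t ^ 2 := by
  obtain ⟨K, hK, hKle⟩ := exists_norm_vacMul_le n
  refine ⟨256 * Real.exp (1 / 4) * K, by positivity, fun q hq hle t ht ht1 => ?_⟩
  have sq : SlowGrowth q := .of_le hq (C := 1) (by simpa using hle)
  have se := slowGrowth_exp_mul hq hle ht ht1
  have e : vacMul (fun u => Complex.exp (t * q u)) - (coherent 0 + (t : ℂ) • vacMul q) =
      vacMul (fun u => Complex.exp (t * q u) + (-1) * (1 + t * q u)) := by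
    rw [vacMul_add se (((slowGrowth_one n).add (sq.const_mul t)).const_mul (-1)),
      vacMul_const_mul ((slowGrowth_one n).add (sq.const_mul t)),
      vacMul_add (slowGrowth_one n) (sq.const_mul t), vacMul_const_mul sq, coherent_zero, neg_one_smul,
      sub_eq_add_neg]
  rw [e]
  refine (hKle _ (256 * Real.exp (1 / 4) * t ^ 2) (by fun_prop) fun u =>
    norm_exp_mul_sub_le (hle u) (sqNorm_nonneg u) ht ht1 rfl).trans (le_of_eq ?_)
  ring

/-! ### Gaussian states as images of the vacuum -/

/-- Separates modulus (governed by W) from phase (governed by U and p). -/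
theorem gaussianWave_eq {n : ℕ} (W U : Matrix (Fin n) (Fin n) ℝ) (a p x : Fin n → ℝ) :
    gaussianWave W U a p x = (((W.det / Real.pi ^ n) ^ (1 / 4 : ℝ) : ℝ) : ℂ) *
      Complex.exp (((-(1 / 2) * ((x - a) ⬝ᵥ W.mulVec (x - a)) : ℝ) : ℂ) +
        ((-(1 / 2) * ((x - a) ⬝ᵥ U.mulVec (x - a)) + p ⬝ᵥ (x - a) : ℝ) : ℂ) * Complex.I) := by
  rw [gaussianWave]
  congr 2
  simp only [dotProduct, Matrix.mulVec, Pi.sub_apply]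
  push_cast
  simp only [Finset.mul_sum, Finset.sum_mul, add_mul, mul_add, Finset.sum_add_distrib, ← add_assoc]
  congr 1
  · congr 1
    · exact Finset.sum_congr rfl fun i _ => Finset.sum_congr rfl fun j _ => by ring
    · exact Finset.sum_congr rfl fun i _ => Finset.sum_congr rfl fun j _ => by ring
  · exact Finset.sum_congr rfl fun i _ => by ring

/-- The data of a pure Gaussian state with first moment `(a, p)`, covariance data `W = Bᵀ B` and
`U`, and global phase `c`. -/
structure GaussianFrame (n : ℕ) where
  B : Matrix (Fin n) (Fin n) ℝ
  U : Matrix (Fin n) (Fin n) ℝ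
  a : Fin n → ℝ
  p : Fin n → ℝ
  c : ℂ
  det_ne : B.det ≠ 0
  symm : U.IsSymm
  norm_c : ‖c‖ = 1

namespace GaussianFrame

variable {n : ℕ} (F : GaussianFrame n)

/-- The normalized coordinates in which the Gaussian state has the modulus of the vacuum. -/
def coord (x : Fin n → ℝ) : Fin n → ℝ := F.B.mulVec (x - F.a)

/-- The factor of constant modulus in the Gaussian unitary that maps the vacuum to the state. -/
def factor (x : Fin n → ℝ) : ℂ :=
  F.c * ((√|F.B.det| : ℝ) : ℂ) * Complex.exp
    (((-(1 / 2) * ((x - F.a) ⬝ᵥ F.U.mulVec (x - F.a)) + F.p ⬝ᵥ (x - F.a) : ℝ) : ℂ) * Complex.I)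

theorem norm_factor (x : Fin n → ℝ) : ‖F.factor x‖ = √|F.B.det| := by
  rw [factor, norm_mul, norm_mul, F.norm_c, Complex.norm_exp_ofReal_mul_I, Complex.norm_real,
    Real.norm_of_nonneg (Real.sqrt_nonneg _)]
  ring

theorem continuous_coord : Continuous F.coord := by
  unfold coord
  exact Continuous.matrix_mulVec continuous_const (by fun_prop)

theorem continuous_factor : Continuous F.factor := by
  unfold factor
  simp only [dotProduct, Matrix.mulVec]
  fun_prop

theorem map_coord : (volume : Measure (Fin n → ℝ)).map F.coord =
    ENNReal.ofReal |F.B.det|⁻¹ • volume := by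
  have h1 := (measurePreserving_sub_right (volume : Measure (Fin n → ℝ)) F.a).map_eq
  have h2 := Real.map_matrix_volume_pi_eq_smul_volume_pi F.det_ne
  rw [← abs_inv, ← h2]
  conv_rhs => rw [← h1]
  rw [Measure.map_map (LinearMap.continuous_of_finiteDimensional _).measurable (by fun_prop)]
  rfl

theorem quasiMeasurePreserving_coord :
    Measure.QuasiMeasurePreserving F.coord volume volume :=
  ⟨F.continuous_coord.measurable, by
    rw [F.map_coord]; exact Measure.smul_absolutelyContinuous⟩

theorem integral_coord {f : (Fin n → ℝ) → ℂ} (hf : AEStronglyMeasurable f volume) :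
    ∫ x, ((|F.B.det| : ℝ) : ℂ) * f (F.coord x) = ∫ u, f u := by
  have h := integral_map (μ := volume) F.continuous_coord.measurable.aemeasurable (f := f) (by
    rw [F.map_coord]; exact hf.smul_measure _)
  rw [F.map_coord, integral_smul_measure, ENNReal.toReal_ofReal (by positivity)] at h
  rw [integral_const_mul, ← h, Complex.real_smul, ← mul_assoc, ← Complex.ofReal_mul,
    mul_inv_cancel₀ (abs_ne_zero.2 F.det_ne)]
  simp

theorem memLp_pull (ψ : Modes n) : MemLp (fun x => F.factor x * ψ (F.coord x)) 2 volume := by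
  have h : MemLp (fun x => ψ (F.coord x)) 2 volume := by
    refine MemLp.comp_of_map (f := F.coord) (g := ψ) ?_ F.continuous_coord.aemeasurable
    rw [F.map_coord]
    exact (Lp.memLp ψ).smul_measure ENNReal.ofReal_ne_top
  refine h.of_le_mul (c := √|F.B.det|)
    (F.continuous_factor.aestronglyMeasurable.mul h.aestronglyMeasurable)
    (Filter.Eventually.of_forall fun x => ?_)
  rw [norm_mul, F.norm_factor]

/-- The Gaussian unitary that maps the vacuum to the Gaussian state, as a linear map. -/
def pullₗ : Modes n →ₗ[ℂ] Modes n where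
  toFun ψ := (F.memLp_pull ψ).toLp _
  map_add' ψ χ := by
    rw [← MemLp.toLp_add, MemLp.toLp_eq_toLp_iff]
    filter_upwards [F.quasiMeasurePreserving_coord.ae_eq_comp (Lp.coeFn_add ψ χ)] with x hx
    simp only [Function.comp_apply, Pi.add_apply] at hx ⊢
    rw [hx, mul_add]
  map_smul' c ψ := by
    rw [RingHom.id_apply, ← MemLp.toLp_const_smul, MemLp.toLp_eq_toLp_iff]
    filter_upwards [F.quasiMeasurePreserving_coord.ae_eq_comp (Lp.coeFn_smul c ψ)] with x hx
    simp only [Function.comp_apply, Pi.smul_apply, smul_eq_mul] at hx ⊢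
    rw [hx, mul_left_comm]

/-- The Gaussian unitary that maps the vacuum to the Gaussian state. -/
def pull : Modes n →ₗᵢ[ℂ] Modes n :=
  F.pullₗ.isometryOfInner fun ψ χ => by
    rw [L2.inner_def, L2.inner_def, ← F.integral_coord
      ((Lp.aestronglyMeasurable ψ).inner (Lp.aestronglyMeasurable χ))]
    refine integral_congr_ae ?_
    filter_upwards [MemLp.coeFn_toLp (F.memLp_pull ψ), MemLp.coeFn_toLp (F.memLp_pull χ)] with x h1 h2
    change ⟪(F.memLp_pull ψ).toLp _ x, (F.memLp_pull χ).toLp _ x⟫_ℂ = _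
    rw [h1, h2]
    simp only [RCLike.inner_apply, map_mul]
    rw [mul_mul_mul_comm, Complex.mul_conj', F.norm_factor, ← Complex.ofReal_pow,
      Real.sq_sqrt (abs_nonneg _)]

theorem coeFn_pull {ψ : Modes n} {f : (Fin n → ℝ) → ℂ} (h : ψ =ᵐ[volume] f) :
    F.pull ψ =ᵐ[volume] fun x => F.factor x * f (F.coord x) := by
  have h1 : F.pull ψ =ᵐ[volume] fun x => F.factor x * ψ (F.coord x) :=
    MemLp.coeFn_toLp (F.memLp_pull ψ)
  filter_upwards [h1, F.quasiMeasurePreserving_coord.ae_eq_comp h] with x h1 h2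
  simp only [Function.comp_apply] at h2
  rw [h1, h2]

/-- The wavefunction of the Gaussian state. -/
def wave (x : Fin n → ℝ) : ℂ := F.c * gaussianWave (F.B.transpose * F.B) F.U F.a F.p x

theorem sqNorm_coord (x : Fin n → ℝ) : sqNorm (F.coord x) =
    (x - F.a) ⬝ᵥ ((F.B.transpose * F.B).mulVec (x - F.a)) := by
  rw [← Matrix.mulVec_mulVec, Matrix.dotProduct_mulVec, Matrix.vecMul_transpose]
  simp [sqNorm, dotProduct, coord, sq]

theorem factor_mul_vac (x : Fin n → ℝ) : F.factor x * vac (F.coord x) = F.wave x := by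
  -- The normalizations agree because det(BᵀB)^{1/4} = |det B|^{1/2}.
  have hN : √|F.B.det| * Real.pi ^ (-(n : ℝ) / 4) =
      ((F.B.transpose * F.B).det / Real.pi ^ n) ^ (1 / 4 : ℝ) := by
    rw [Matrix.det_mul, Matrix.det_transpose, ← abs_mul_abs_self F.B.det, ← pow_two,
      Real.div_rpow (by positivity) (by positivity), Real.sqrt_eq_rpow, ← Real.rpow_natCast,
      ← Real.rpow_natCast, ← Real.rpow_mul (abs_nonneg _), ← Real.rpow_mul Real.pi_pos.le,
      neg_div, Real.rpow_neg Real.pi_pos.le, ← div_eq_mul_inv]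
    norm_num
    congr 2
    ring
  rw [wave, gaussianWave_eq, ← hN, factor, vac, F.sqNorm_coord, Complex.ofReal_mul,
    Complex.ofReal_mul, Complex.ofReal_exp, Complex.exp_add, neg_div, div_eq_inv_mul,
    ← neg_mul, ← one_div]
  ring_nf

theorem coeFn_pull_vacMul {f : (Fin n → ℝ) → ℂ} (hf : SlowGrowth f) :
    F.pull (vacMul f) =ᵐ[volume] fun x => F.wave x * f (F.coord x) := by
  filter_upwards [F.coeFn_pull hf.coeFn_vacMul] with x hx
  rw [hx, ← F.factor_mul_vac, mul_assoc]

theorem wave_ne_zero (x : Fin n → ℝ) : F.wave x ≠ 0 := by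
  rw [← F.factor_mul_vac]
  refine mul_ne_zero ?_ (vac_ne_zero _)
  rw [← norm_ne_zero_iff, F.norm_factor]
  have := F.det_ne
  positivity

/-- The Gaussian state. -/
def state : Modes n := F.pull (coherent 0)

theorem norm_state : ‖F.state‖ = 1 := by
  rw [state, LinearIsometry.norm_map, norm_coherent_zero]

theorem coeFn_state : F.state =ᵐ[volume] F.wave := by
  rw [state, coherent_zero]
  filter_upwards [F.coeFn_pull_vacMul (slowGrowth_one n)] with x hx
  rw [hx, mul_one]

theorem posDef : (F.B.transpose * F.B).PosDef := by
  have h : IsUnit F.B := (Matrix.isUnit_iff_isUnit_det _).2 (isUnit_iff_ne_zero.2 F.det_ne)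
  have := Matrix.PosDef.conjTranspose_mul_self F.B (Matrix.mulVec_injective_of_isUnit h)
  rwa [Matrix.conjTranspose_eq_transpose_of_trivial] at this

theorem isGaussianWithMean_state : IsGaussianWithMean F.a F.p F.state :=
  ⟨_, F.U, F.c, F.posDef, F.symm, F.norm_c, F.coeFn_state⟩

end GaussianFrame

theorem IsGaussianWithMean.exists_frame {n : ℕ} {a p : Fin n → ℝ} {φ : Modes n}
    (h : IsGaussianWithMean a p φ) :
    ∃ F : GaussianFrame n, F.a = a ∧ F.p = p ∧ F.state = φ := by
  obtain ⟨W, U, c, hW, hU, hc, hφ⟩ := h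
  obtain ⟨B, rfl⟩ : ∃ B : Matrix (Fin n) (Fin n) ℝ, W = B.transpose * B := by
    open scoped MatrixOrder in
    obtain ⟨B, hB⟩ := CStarAlgebra.nonneg_iff_eq_star_mul_self.1 hW.posSemidef.nonneg
    exact ⟨B, by rw [hB, Matrix.star_eq_conjTranspose, Matrix.conjTranspose_eq_transpose_of_trivial]⟩
  have hdet : B.det ≠ 0 := by
    have := hW.det_pos
    rw [Matrix.det_mul, Matrix.det_transpose] at this
    exact fun h0 => by simp [h0] at this
  refine ⟨⟨B, U, a, p, c, hdet, hU, hc⟩, rfl, rfl, ?_⟩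
  apply Lp.ext
  filter_upwards [hφ, GaussianFrame.coeFn_state ⟨B, U, a, p, c, hdet, hU, hc⟩] with x h1 h2
  rw [h1, h2, GaussianFrame.wave]

theorem IsGaussianWithMean.norm_eq_one {n : ℕ} {a p : Fin n → ℝ} {φ : Modes n}
    (h : IsGaussianWithMean a p φ) : ‖φ‖ = 1 := by
  obtain ⟨F, -, -, rfl⟩ := h.exists_frame
  exact F.norm_state

instance instNonemptyZeroMeanGaussianStates (n : ℕ) : Nonempty (zeroMeanGaussianStates n) :=
  let F : GaussianFrame n := ⟨1, 0, 0, 0, 1, by simp, Matrix.isSymm_zero, by simp⟩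
  ⟨⟨F.state, F.isGaussianWithMean_state⟩⟩

instance instNonemptyGaussianStates (n : ℕ) : Nonempty (gaussianStates n) :=
  let F : GaussianFrame n := ⟨1, 0, 0, 0, 1, by simp, Matrix.isSymm_zero, by simp⟩
  ⟨⟨F.state, _, _, F.isGaussianWithMean_state⟩⟩

/-! ### Uniqueness of Fourier transforms and totality of the coherent states -/

/-- The positive and negative parts of r are densities of finite measures with equal characteristic
functions, so the measures, and then the densities, coincide. -/
theorem ae_eq_zero_of_fourier_eq_zero_real {n : ℕ} {r : (Fin n → ℝ) → ℝ} (hr : Integrable r)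
    (h : ∀ w : Fin n → ℝ, ∫ x, Complex.exp ((w ⬝ᵥ x : ℝ) * Complex.I) * (r x : ℂ) = 0) :
    r =ᵐ[volume] 0 := by
  have hp : ∫⁻ x, ENNReal.ofReal (r x) ≠ ⊤ := hr.lintegral_lt_top.ne
  have hm : ∫⁻ x, ENNReal.ofReal (-r x) ≠ ⊤ := hr.neg.lintegral_lt_top.ne
  have hpm : AEMeasurable (fun x => ENNReal.ofReal (r x)) := hr.aemeasurable.ennreal_ofReal
  have hmm : AEMeasurable (fun x => ENNReal.ofReal (-r x)) := hr.neg.aemeasurable.ennreal_ofReal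
  have := isFiniteMeasure_withDensity hp
  have := isFiniteMeasure_withDensity hm
  have key : (volume.withDensity fun x => ENNReal.ofReal (r x)) =
      volume.withDensity fun x => ENNReal.ofReal (-r x) := by
    refine Measure.ext_of_charFunDual (funext fun L => ?_)
    rw [charFunDual_apply, charFunDual_apply,
      integral_withDensity_eq_integral_toReal_smul₀ hpm (by simp),
      integral_withDensity_eq_integral_toReal_smul₀ hmm (by simp)]
    have hL : ∀ x, L x = (fun i => L (Pi.single i 1)) ⬝ᵥ x := fun x => by
      conv_lhs => rw [← LinearMap.sum_single_apply (fun _ => ℝ) x, map_sum]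
      refine Finset.sum_congr rfl fun i _ => ?_
      have : (Pi.single i (x i) : Fin n → ℝ) = x i • Pi.single i 1 := by
        rw [← Pi.single_smul, smul_eq_mul, mul_one]
      rw [this, map_smul, smul_eq_mul, mul_comm]
    have hbd : ∀ {f : (Fin n → ℝ) → ℝ}, Integrable f →
        Integrable fun x => f x • Complex.exp (L x * Complex.I) := fun {f} hf => by
      refine (hf.norm.mono' (f := fun x => f x • Complex.exp (L x * Complex.I)) ?_ ?_)
      · exact hf.aestronglyMeasurable.smul (by fun_prop)
      · refine Filter.Eventually.of_forall fun x => ?_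
        rw [norm_smul, Complex.norm_exp_ofReal_mul_I, mul_one]
    rw [← sub_eq_zero, ← integral_sub]
    · rw [← h fun i => L (Pi.single i 1)]
      refine integral_congr_ae (Filter.Eventually.of_forall fun x => ?_)
      simp only [ENNReal.toReal_ofReal', ← sub_smul, ← hL]
      rw [max_zero_sub_eq_self, Complex.real_smul, mul_comm]
    · simp only [ENNReal.toReal_ofReal']
      exact hbd hr.pos_part
    · simp only [ENNReal.toReal_ofReal']
      exact hbd hr.neg_part
  rw [withDensity_eq_iff hpm hmm hp] at key
  filter_upwards [key] with x hx
  rcases le_total 0 (r x) with h0 | h0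
  · rw [ENNReal.ofReal_of_nonpos (neg_nonpos.2 h0), ENNReal.ofReal_eq_zero] at hx
    exact le_antisymm hx h0
  · rw [ENNReal.ofReal_of_nonpos h0, eq_comm, ENNReal.ofReal_eq_zero] at hx
    exact le_antisymm h0 (neg_nonpos.1 hx)

/-- Conjugating at −w shows that the transform of conj g vanishes too, which reduces the claim to
real and imaginary parts. -/
theorem ae_eq_zero_of_fourier_eq_zero {n : ℕ} {g : (Fin n → ℝ) → ℂ} (hg : Integrable g)
    (h : ∀ w : Fin n → ℝ, ∫ x, Complex.exp ((w ⬝ᵥ x : ℝ) * Complex.I) * g x = 0) :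
    g =ᵐ[volume] 0 := by
  have hbd : ∀ (w : Fin n → ℝ) {f : (Fin n → ℝ) → ℂ}, Integrable f →
      Integrable fun x => Complex.exp ((w ⬝ᵥ x : ℝ) * Complex.I) * f x := fun w {f} hf => by
    refine hf.norm.mono' ?_ ?_
    · refine AEStronglyMeasurable.mul ?_ hf.aestronglyMeasurable
      exact Continuous.aestronglyMeasurable (by simp only [dotProduct]; fun_prop)
    · refine Filter.Eventually.of_forall fun x => ?_
      rw [norm_mul, Complex.norm_exp_ofReal_mul_I, one_mul]
  have hconj : ∀ w : Fin n → ℝ, ∫ x, Complex.exp ((w ⬝ᵥ x : ℝ) * Complex.I) * conj (g x) = 0 := by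
    intro w
    have h1 := congrArg conj (h (-w))
    rw [← integral_conj, map_zero] at h1
    rw [← h1]
    refine integral_congr_ae (Filter.Eventually.of_forall fun x => ?_)
    simp only [map_mul, ← Complex.exp_conj, Complex.conj_I, neg_dotProduct, Complex.ofReal_neg, map_neg,
      Complex.conj_ofReal, neg_mul_neg]
  have hgc : Integrable fun x => conj (g x) :=
    hg.norm.mono' (Complex.continuous_conj.comp_aestronglyMeasurable hg.aestronglyMeasurable)
      (Filter.Eventually.of_forall fun x => by rw [Complex.norm_conj])
  have hre : (fun x => (g x).re) =ᵐ[volume] 0 := by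
    refine ae_eq_zero_of_fourier_eq_zero_real hg.re fun w => ?_
    have e : ∀ x, Complex.exp ((w ⬝ᵥ x : ℝ) * Complex.I) * ((g x).re : ℂ) =
        (1 / 2) * (Complex.exp ((w ⬝ᵥ x : ℝ) * Complex.I) * g x +
          Complex.exp ((w ⬝ᵥ x : ℝ) * Complex.I) * conj (g x)) := fun x => by
      rw [← mul_add, Complex.add_conj]; push_cast; ring
    simp only [e]
    rw [integral_const_mul, integral_add (hbd w hg) (hbd w hgc), h, hconj]
    simp
  have him : (fun x => (g x).im) =ᵐ[volume] 0 := by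
    refine ae_eq_zero_of_fourier_eq_zero_real hg.im fun w => ?_
    have e : ∀ x, Complex.exp ((w ⬝ᵥ x : ℝ) * Complex.I) * ((g x).im : ℂ) =
        (-Complex.I / 2) * (Complex.exp ((w ⬝ᵥ x : ℝ) * Complex.I) * g x -
          Complex.exp ((w ⬝ᵥ x : ℝ) * Complex.I) * conj (g x)) := fun x => by
      rw [← mul_sub, Complex.sub_conj]
      push_cast
      linear_combination (Complex.exp (↑(w ⬝ᵥ x) * Complex.I) * (g x).im) * Complex.I_sq
    simp only [e]
    rw [integral_const_mul, integral_sub (hbd w hg) (hbd w hgc), h, hconj]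
    simp
  filter_upwards [hre, him] with x h1 h2
  exact Complex.ext h1 h2

namespace GaussianFrame

variable {n : ℕ} (F : GaussianFrame n)

/-- Up to a nonzero constant the overlap is the Fourier transform of conj(wave)·ψ at w = −√2 Bᵀy.
Invertibility of B makes every w occur, and the wave has no zeros. -/
theorem eq_zero_of_forall_inner_coherent {ψ : Modes n}
    (h : ∀ y, ⟪F.pull (coherent y), ψ⟫_ℂ = 0) : ψ = 0 := by
  have hint : Integrable fun x => conj (F.wave x) * ψ x := by
    have h1 := (Lp.memLp F.state).star.integrable_mul (Lp.memLp ψ)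
    refine h1.congr ?_
    filter_upwards [F.coeFn_state] with x hx
    simp [hx]
  have hz := ae_eq_zero_of_fourier_eq_zero hint fun w => by
    have hB : IsUnit F.B.transpose.det := by
      rw [Matrix.det_transpose]; exact isUnit_iff_ne_zero.2 F.det_ne
    set y : Fin n → ℝ := -((√2)⁻¹ • (F.B.transpose⁻¹).mulVec w) with hy
    have hyw : -(√2 • F.B.transpose.mulVec y) = w := by
      rw [hy, Matrix.mulVec_neg, Matrix.mulVec_smul, smul_neg, neg_neg, smul_smul,
        mul_inv_cancel₀ (by positivity), one_smul, Matrix.mulVec_mulVec,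
        Matrix.mul_nonsing_inv _ hB, Matrix.one_mulVec]
    have h1 := h y
    rw [L2.inner_def] at h1
    have e : ∀ᵐ x, ⟪F.pull (coherent y) x, ψ x⟫_ℂ =
        (Complex.exp ((∑ i, (y i : ℂ) ^ 2) / 2) * Complex.exp (-((w ⬝ᵥ F.a : ℝ) * Complex.I))) *
        (Complex.exp ((w ⬝ᵥ x : ℝ) * Complex.I) * (conj (F.wave x) * ψ x)) := by
      filter_upwards [F.coeFn_pull_vacMul (slowGrowth_expFun y)] with x hx
      have hexp : conj (expFun y (F.coord x)) = Complex.exp ((∑ i, (y i : ℂ) ^ 2) / 2) *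
          (Complex.exp (-((w ⬝ᵥ F.a : ℝ) * Complex.I)) *
            Complex.exp ((w ⬝ᵥ x : ℝ) * Complex.I)) := by
        have h2 : w ⬝ᵥ x - w ⬝ᵥ F.a = -(√2 * (y ⬝ᵥ F.coord x)) := by
          rw [← dotProduct_sub, ← hyw, neg_dotProduct, smul_dotProduct, coord,
            Matrix.dotProduct_mulVec, Matrix.mulVec_transpose, smul_eq_mul]
        have h3 : conj (∑ i, expCoeff y i * (F.coord x i : ℂ)) =
            ((w ⬝ᵥ x - w ⬝ᵥ F.a : ℝ) : ℂ) * Complex.I := by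
          rw [h2]
          simp only [dotProduct, expCoeff, map_sum, map_mul, Complex.conj_I, Complex.conj_ofReal]
          push_cast
          rw [Finset.mul_sum, ← Finset.sum_neg_distrib, Finset.sum_mul]
          exact Finset.sum_congr rfl fun i _ => by ring
        have h4 : conj ((∑ i, (y i : ℂ) ^ 2) / 2) = (∑ i, (y i : ℂ) ^ 2) / 2 := by
          simp [Complex.conj_ofNat]
        rw [expFun, map_mul, ← Complex.exp_conj, ← Complex.exp_conj, h3, h4]
        simp only [← Complex.exp_add]
        congr 1
        push_cast
        ring
      rw [coherent, hx, RCLike.inner_apply, map_mul, hexp]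
      ring
    rw [integral_congr_ae e, integral_const_mul] at h1
    exact (mul_eq_zero.1 h1).resolve_left (mul_ne_zero (Complex.exp_ne_zero _) (Complex.exp_ne_zero _))
  apply Lp.ext
  filter_upwards [hz, Lp.coeFn_zero ℂ 2 (volume : Measure (Fin n → ℝ))] with x h1 h2
  rw [h2]
  exact (mul_eq_zero.1 h1).resolve_left
    ((map_ne_zero_iff _ (RingHom.injective _)).2 (F.wave_ne_zero x))

theorem dense_span_coherent :
    (Submodule.span ℂ (Set.range fun y => F.pull (coherent y))).topologicalClosure = ⊤ := by
  rw [Submodule.topologicalClosure_eq_top_iff, Submodule.eq_bot_iff]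
  intro ψ hψ
  refine F.eq_zero_of_forall_inner_coherent fun y => ?_
  exact (Submodule.mem_orthogonal _ _).1 hψ _ (Submodule.subset_span ⟨y, rfl⟩)

end GaussianFrame

/-! ### Perturbed Gaussian states are Gaussian -/

theorem quadForm_add {n : ℕ} {M : Matrix (Fin n) (Fin n) ℝ} (hM : M.IsSymm) (y d : Fin n → ℝ) :
    (y + d) ⬝ᵥ M.mulVec (y + d) = y ⬝ᵥ M.mulVec y + 2 * (M.mulVec d ⬝ᵥ y) + d ⬝ᵥ M.mulVec d := by
  have h : d ⬝ᵥ M.mulVec y = M.mulVec d ⬝ᵥ y := by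
    rw [Matrix.dotProduct_mulVec, ← Matrix.mulVec_transpose, hM.eq]
  rw [Matrix.mulVec_add, dotProduct_add, add_dotProduct, add_dotProduct, h,
    dotProduct_comm y (M.mulVec d)]
  ring

theorem exists_isGaussianWithMean_of_ae_eq {n : ℕ} {W U : Matrix (Fin n) (Fin n) ℝ}
    {a p : Fin n → ℝ} {κ : ℂ} {ψ : Modes n} (hκ : κ ≠ 0) (hW : W.PosDef) (hU : U.IsSymm)
    (h : ψ =ᵐ[volume] fun x => κ * gaussianWave W U a p x) :
    ∃ φ, IsGaussianWithMean a p φ ∧ ψ = κ • φ := by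
  refine ⟨κ⁻¹ • ψ, ⟨W, U, 1, hW, hU, by simp, ?_⟩, by rw [smul_smul, mul_inv_cancel₀ hκ, one_smul]⟩
  filter_upwards [h, Lp.coeFn_smul κ⁻¹ ψ] with x h1 h2
  rw [h2, Pi.smul_apply, h1, smul_eq_mul, one_mul, inv_mul_cancel_left₀ hκ]

namespace GaussianFrame

variable {n : ℕ} (F : GaussianFrame n)

theorem c_ne_zero : F.c ≠ 0 := by
  rw [← norm_ne_zero_iff, F.norm_c]; exact one_ne_zero

theorem coord_apply (x : Fin n → ℝ) (k : Fin n) : F.coord x k = F.B k ⬝ᵥ (x - F.a) := rfl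

/-- Completing the square: the real part of ω shifts the mean position by d = W⁻¹r, the imaginary
part adds s to the momentum, and −Ud recentres the quadratic phase. Constants go into κ. -/
theorem exists_pull_vacMul_exp_coord (ω : ℂ) (k : Fin n) {t : ℝ}
    (hs : SlowGrowth fun u : Fin n → ℝ => Complex.exp (t * (ω * u k))) :
    ∃ (κ : ℂ) (a p : Fin n → ℝ) (φ : Modes n), IsGaussianWithMean a p φ ∧
      F.pull (vacMul fun u => Complex.exp (t * (ω * u k))) = κ • φ := by
  set W := F.B.transpose * F.B with hW
  have hdet : IsUnit W.det := isUnit_iff_ne_zero.2 F.posDef.det_pos.ne'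
  have hWs : W.IsSymm := by
    rw [Matrix.IsSymm, hW, Matrix.transpose_mul, Matrix.transpose_transpose]
  set r : Fin n → ℝ := (t * ω.re) • F.B k with hr
  set s : Fin n → ℝ := (t * ω.im) • F.B k with hs'
  set d : Fin n → ℝ := W⁻¹.mulVec r with hd
  have hWd : W.mulVec d = r := by
    rw [hd, Matrix.mulVec_mulVec, Matrix.mul_nonsing_inv _ hdet, Matrix.one_mulVec]
  set κ : ℂ := F.c * Complex.exp (((1 / 2 * (d ⬝ᵥ r) : ℝ) : ℂ) +
    ((-(1 / 2) * (d ⬝ᵥ F.U.mulVec d) + (F.p + s) ⬝ᵥ d : ℝ) : ℂ) * Complex.I) with hκ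
  obtain ⟨φ, h1, h2⟩ := exists_isGaussianWithMean_of_ae_eq (κ := κ) (a := F.a + d)
    (p := F.p + s - F.U.mulVec d) (mul_ne_zero F.c_ne_zero (Complex.exp_ne_zero _)) F.posDef F.symm
    (ψ := F.pull (vacMul fun u => Complex.exp (t * (ω * u k)))) (by
      filter_upwards [F.coeFn_pull_vacMul hs] with x hx
      rw [hx, wave, gaussianWave_eq, gaussianWave_eq, ← hW, hκ, mul_assoc, mul_assoc, mul_assoc,
        mul_left_comm (Complex.exp _), ← Complex.exp_add, ← Complex.exp_add]
      congr 3
      set y := x - (F.a + d) with hy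
      have hxy : x - F.a = y + d := by rw [hy]; abel
      have e : (t : ℂ) * (ω * F.coord x k) =
          ((r ⬝ᵥ (x - F.a) : ℝ) : ℂ) + ((s ⬝ᵥ (x - F.a) : ℝ) : ℂ) * Complex.I := by
        rw [coord_apply, hr, hs', smul_dotProduct, smul_dotProduct, smul_eq_mul, smul_eq_mul]
        conv_lhs => rw [← Complex.re_add_im ω]
        push_cast
        ring
      rw [e, hxy, quadForm_add hWs, quadForm_add F.symm, hWd]
      simp only [dotProduct_add, add_dotProduct, sub_dotProduct]
      rw [dotProduct_comm d r]
      push_cast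
      ring)
  exact ⟨κ, _, _, φ, h1, h2⟩

/-- W and U change by multiples of a symmetric S with zᵀSz = 2(Bz)_k(Bz)_l, and the mean is
untouched. For t ≤ 1/16 the form zᵀWz = |Bz|² changes by at most |Bz|²/8, so it remains positive
definite. -/
theorem exists_pull_vacMul_exp_coord_mul_coord {ω : ℂ} (hω : ‖ω‖ ≤ 1) (k l : Fin n) {t : ℝ}
    (ht : 0 ≤ t) (ht1 : t ≤ 1 / 16)
    (hs : SlowGrowth fun u : Fin n → ℝ => Complex.exp (t * (ω * (u k * u l)))) :
    ∃ (κ : ℂ) (φ : Modes n), IsGaussianWithMean F.a F.p φ ∧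
      F.pull (vacMul fun u => Complex.exp (t * (ω * (u k * u l)))) = κ • φ := by
  set W := F.B.transpose * F.B with hW
  set S : Matrix (Fin n) (Fin n) ℝ :=
    Matrix.vecMulVec (F.B k) (F.B l) + Matrix.vecMulVec (F.B l) (F.B k) with hS
  have hSs : S.IsSymm := by
    rw [Matrix.IsSymm, hS, Matrix.transpose_add, Matrix.transpose_vecMulVec,
      Matrix.transpose_vecMulVec, add_comm]
  have hSq : ∀ z : Fin n → ℝ, z ⬝ᵥ S.mulVec z = 2 * ((F.B k ⬝ᵥ z) * (F.B l ⬝ᵥ z)) := fun z => by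
    rw [hS, Matrix.add_mulVec, Matrix.vecMulVec_mulVec, Matrix.vecMulVec_mulVec, dotProduct_add]
    simp only [op_smul_eq_smul, dotProduct_smul, smul_eq_mul]
    rw [dotProduct_comm z, dotProduct_comm z]
    ring
  set W' := W - (t * ω.re) • S with hW'
  set U' := F.U - (t * ω.im) • S with hU'
  have hU's : U'.IsSymm := F.symm.sub (hSs.smul _)
  have hW's : W'.PosDef := by
    refine Matrix.PosDef.of_dotProduct_mulVec_pos ?_ fun z hz => ?_
    · rw [Matrix.IsHermitian, Matrix.conjTranspose_eq_transpose_of_trivial, hW',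
        Matrix.transpose_sub, Matrix.transpose_smul, hSs.eq, hW, Matrix.transpose_mul,
        Matrix.transpose_transpose]
    · have h0 : 0 < z ⬝ᵥ W.mulVec z := by simpa using F.posDef.dotProduct_mulVec_pos hz
      have h1 : z ⬝ᵥ W.mulVec z = sqNorm (F.B.mulVec z) := by
        rw [hW, ← Matrix.mulVec_mulVec, Matrix.dotProduct_mulVec, Matrix.vecMul_transpose]
        simp [sqNorm, dotProduct, sq]
      have h2 : |(F.B k ⬝ᵥ z) * (F.B l ⬝ᵥ z)| ≤ sqNorm (F.B.mulVec z) := by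
        have := norm_coord_mul_coord_le (F.B.mulVec z) k l
        rwa [← Complex.ofReal_mul, Complex.norm_real] at this
      have h3 : |ω.re| ≤ 1 := (Complex.abs_re_le_norm ω).trans hω
      have h4 : |t * ω.re * (2 * ((F.B k ⬝ᵥ z) * (F.B l ⬝ᵥ z)))| ≤
          1 / 16 * 1 * (2 * sqNorm (F.B.mulVec z)) := by
        rw [abs_mul, abs_mul, abs_mul, abs_two, abs_of_nonneg ht]
        gcongr
      have h5 := le_abs_self (t * ω.re * (2 * ((F.B k ⬝ᵥ z) * (F.B l ⬝ᵥ z))))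
      rw [star_trivial, hW', Matrix.sub_mulVec, Matrix.smul_mulVec, dotProduct_sub, dotProduct_smul,
        hSq, smul_eq_mul]
      rw [h1] at h0 ⊢
      linarith
  have hN : (((W'.det / Real.pi ^ n) ^ (1 / 4 : ℝ) : ℝ) : ℂ) ≠ 0 := by
    have := hW's.det_pos
    rw [Complex.ofReal_ne_zero]
    positivity
  have hN0 : (((W.det / Real.pi ^ n) ^ (1 / 4 : ℝ) : ℝ) : ℂ) ≠ 0 := by
    have := F.posDef.det_pos
    rw [Complex.ofReal_ne_zero]
    positivity
  set N := (((W.det / Real.pi ^ n) ^ (1 / 4 : ℝ) : ℝ) : ℂ) with hNdef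
  set N' := (((W'.det / Real.pi ^ n) ^ (1 / 4 : ℝ) : ℝ) : ℂ) with hN'def
  obtain ⟨φ, h1, h2⟩ := exists_isGaussianWithMean_of_ae_eq (κ := F.c * (N / N')) (a := F.a)
    (p := F.p) (mul_ne_zero F.c_ne_zero (div_ne_zero hN0 hN)) hW's hU's
    (ψ := F.pull (vacMul fun u => Complex.exp (t * (ω * (u k * u l))))) (by
      filter_upwards [F.coeFn_pull_vacMul hs] with x hx
      rw [hx, wave, gaussianWave_eq, gaussianWave_eq, ← hW, ← hNdef, ← hN'def, mul_assoc, mul_assoc,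
        mul_assoc, ← mul_assoc (N / N'), div_mul_cancel₀ _ hN, ← Complex.exp_add]
      congr 3
      rw [coord_apply, coord_apply]
      generalize x - F.a = z
      rw [hW', hU', Matrix.sub_mulVec, Matrix.smul_mulVec,
        Matrix.sub_mulVec, Matrix.smul_mulVec, dotProduct_sub, dotProduct_smul, dotProduct_sub,
        dotProduct_smul, hSq, smul_eq_mul, smul_eq_mul]
      conv_lhs => rw [← Complex.re_add_im ω]
      push_cast
      ring)
  exact ⟨_, φ, h1, h2⟩

/-! ### Rotation of products of coherent states -/

/-- Writes the exponent through quadratic and linear forms in x − a, ready to be summed over the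
copies as traces. -/
theorem wave_mul_expFun (y x : Fin n → ℝ) : F.wave x * expFun y (F.coord x) =
    (F.c * ((((F.B.transpose * F.B).det / Real.pi ^ n) ^ (1 / 4 : ℝ) : ℝ) : ℂ)) * Complex.exp
      (((-(1 / 2) * ((x - F.a) ⬝ᵥ (F.B.transpose * F.B).mulVec (x - F.a)) + 1 / 2 * (y ⬝ᵥ y) : ℝ) : ℂ) +
      ((-(1 / 2) * ((x - F.a) ⬝ᵥ F.U.mulVec (x - F.a)) + F.p ⬝ᵥ (x - F.a) +
        √2 * (y ⬝ᵥ F.B.mulVec (x - F.a)) : ℝ) : ℂ) * Complex.I) := by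
  have h1 : (∑ i, (y i : ℂ) ^ 2) / 2 = ((1 / 2 * (y ⬝ᵥ y) : ℝ) : ℂ) := by
    simp only [dotProduct]
    push_cast
    rw [div_eq_inv_mul, ← one_div]
    congr 1
    exact Finset.sum_congr rfl fun i _ => by ring
  have h2 : ∑ i, expCoeff y i * (F.coord x i : ℂ) =
      ((√2 * (y ⬝ᵥ F.B.mulVec (x - F.a)) : ℝ) : ℂ) * Complex.I := by
    simp only [dotProduct, expCoeff, coord]
    push_cast
    rw [Finset.mul_sum, Finset.sum_mul]
    exact Finset.sum_congr rfl fun i _ => by ring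
  rw [wave, gaussianWave_eq, expFun, h1, h2, ← Complex.exp_add, ← mul_assoc, mul_assoc (_ * _),
    ← Complex.exp_add]
  congr 2
  push_cast
  ring

/-- The orthogonal transformations of the copies that leave the `k`-fold tensor power of the Gaussian
state invariant. -/
def Fixes {k : ℕ} (F : GaussianFrame n) (o : Matrix (Fin k) (Fin k) ℝ) : Prop :=
  ((∀ l, ∑ j, o l j = 1) ∧ ∀ j, ∑ l, o l j = 1) ∨ (F.a = 0 ∧ F.p = 0)

theorem sum_quadForm {m k : ℕ} (M : Matrix (Fin m) (Fin n) ℝ) (Y : Matrix (Fin m) (Fin k) ℝ)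
    (Z : Matrix (Fin n) (Fin k) ℝ) :
    ∑ j, (fun i => Y i j) ⬝ᵥ M.mulVec (fun i => Z i j) = (Y.transpose * M * Z).trace := by
  rw [Matrix.mul_assoc, Matrix.trace]
  refine Finset.sum_congr rfl fun j _ => ?_
  simp only [Matrix.diag_apply, Matrix.mul_apply, dotProduct, Matrix.mulVec, Matrix.transpose_apply]

/-- With the copies as columns of Z, the quadratic terms are traces invariant under Z ↦ Zo, while
cyclicity in the coupling tr(YᵀBZo) moves o over to Y. For a nonzero mean, column sums equal to 1
keep a in place and row sums equal to 1 preserve the p-term. -/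
theorem rotate_tensor_coherent {k : ℕ} (o : Matrix.orthogonalGroup (Fin k) ℝ)
    (ho : F.Fixes (o : Matrix (Fin k) (Fin k) ℝ)) (Y : Matrix (Fin n) (Fin k) ℝ) :
    rotate n o (tensor n k fun j => F.pull (coherent fun i => Y i j)) =
      tensor n k fun j => F.pull (coherent fun i =>
        (Y * (o : Matrix (Fin k) (Fin k) ℝ).transpose) i j) := by
  set R := (o : Matrix (Fin k) (Fin k) ℝ) with hR
  have hRR : R * R.transpose = 1 := (Matrix.mem_orthogonalGroup_iff _ _).1 o.2
  have hRR' : R.transpose * R = 1 := (Matrix.mem_orthogonalGroup_iff' _ _).1 o.2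
  apply Lp.ext
  have hl := coeFn_rotate_tensor o fun j =>
    F.coeFn_pull_vacMul (slowGrowth_expFun fun i => Y i j)
  have hr := coeFn_tensor fun j =>
    F.coeFn_pull_vacMul (slowGrowth_expFun fun i => (Y * R.transpose) i j)
  filter_upwards [hl, hr] with x h1 h2
  simp only [coherent]
  rw [h1, h2]
  simp only [← hR, wave_mul_expFun, Finset.prod_mul_distrib, ← Complex.exp_sum]
  congr 2
  set Z : Matrix (Fin n) (Fin k) ℝ := Matrix.of fun i j => x i j - F.a i with hZ
  have hz : ∀ j, (fun i => x i j) - F.a = fun i => Z i j := fun j => rfl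
  have hz' : ∀ j, (fun i => Matrix.vecMul (x i) R j) - F.a = fun i => (Z * R) i j := fun j => by
    ext1 i
    simp only [Pi.sub_apply, Matrix.vecMul, dotProduct, Matrix.mul_apply, hZ, Matrix.of_apply,
      sub_mul, Finset.sum_sub_distrib, ← Finset.mul_sum]
    rcases ho with ho | ho
    · rw [ho.2 j, mul_one]
    · simp [ho.1]
  have hp : ∑ j, F.p ⬝ᵥ (fun i => (Z * R) i j) = ∑ j, F.p ⬝ᵥ fun i => Z i j := by
    rcases ho with ho | ho
    · simp only [dotProduct, Matrix.mul_apply]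
      rw [Finset.sum_comm, Finset.sum_comm (γ := Fin k)]
      refine Finset.sum_congr rfl fun i _ => ?_
      rw [← Finset.mul_sum, ← Finset.mul_sum, Finset.sum_comm]
      simp only [← Finset.mul_sum, ho.1, mul_one]
    · simp [ho.2]
  have hM : ∀ M : Matrix (Fin n) (Fin n) ℝ,
      ∑ j, (fun i => (Z * R) i j) ⬝ᵥ M.mulVec (fun i => (Z * R) i j) =
        ∑ j, (fun i => Z i j) ⬝ᵥ M.mulVec (fun i => Z i j) := fun M => by
    rw [sum_quadForm, sum_quadForm, Matrix.transpose_mul, ← Matrix.mul_assoc, Matrix.trace_mul_comm,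
      ← Matrix.mul_assoc, ← Matrix.mul_assoc, ← Matrix.mul_assoc, hRR, Matrix.one_mul]
  have hY : ∑ j, (fun i => (Y * R.transpose) i j) ⬝ᵥ (fun i => (Y * R.transpose) i j) =
      ∑ j, (fun i => Y i j) ⬝ᵥ fun i => Y i j := by
    have h1 := sum_quadForm 1 (Y * R.transpose) (Y * R.transpose)
    have h2 := sum_quadForm 1 Y Y
    simp only [Matrix.one_mulVec, Matrix.mul_one] at h1 h2
    rw [h1, h2, Matrix.transpose_mul, Matrix.transpose_transpose, ← Matrix.mul_assoc,
      Matrix.trace_mul_comm, ← Matrix.mul_assoc, ← Matrix.mul_assoc, hRR', Matrix.one_mul]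
  have hYB : ∑ j, (fun i => Y i j) ⬝ᵥ F.B.mulVec (fun i => (Z * R) i j) =
      ∑ j, (fun i => (Y * R.transpose) i j) ⬝ᵥ F.B.mulVec (fun i => Z i j) := by
    rw [sum_quadForm, sum_quadForm, Matrix.transpose_mul, Matrix.transpose_transpose,
      ← Matrix.mul_assoc, Matrix.trace_mul_comm, ← Matrix.mul_assoc, ← Matrix.mul_assoc]
  simp only [hz, hz', Finset.sum_add_distrib, ← Finset.sum_mul, ← Complex.ofReal_sum,
    ← Finset.mul_sum, hM, hY, hYB, hp]

theorem inner_tensor_coherent {k : ℕ} (Y Y' : Matrix (Fin n) (Fin k) ℝ) :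
    ⟪tensor n k fun j => F.pull (coherent fun i => Y i j),
      tensor n k fun j => F.pull (coherent fun i => Y' i j)⟫_ℂ =
    Complex.exp (∑ j, ∑ i, (Y i j : ℂ) * Y' i j) := by
  rw [inner_tensor, Complex.exp_sum]
  exact Finset.prod_congr rfl fun j _ => by rw [LinearIsometry.inner_map_map, inner_coherent]

/-- The matrix with column `j` equal to `y` and all other columns zero. -/
def column {k : ℕ} (j : Fin k) (y : Fin n → ℝ) : Matrix (Fin n) (Fin k) ℝ :=
  Matrix.of fun i l => if l = j then y i else 0

theorem slotSum_coherent (k : ℕ) (y : Fin n → ℝ) : slotSum k F.state (F.pull (coherent y)) =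
    ∑ j, tensor n k fun l => F.pull (coherent fun i => column j y i l) := by
  rw [slotSum_apply]
  refine Finset.sum_congr rfl fun j _ => congrArg _ (funext fun l => ?_)
  by_cases h : l = j
  · subst h; simp [column]
  · simp only [column, Matrix.of_apply, h, if_false, Function.update_of_ne h]
    rfl

/-- Only column j of the left factor is nonzero, and column j of the rotated right factor is
o_{jl}y'. -/
theorem inner_slotSum_rotate_slotSum {k : ℕ} (o : Matrix.orthogonalGroup (Fin k) ℝ)
    (ho : F.Fixes (o : Matrix (Fin k) (Fin k) ℝ)) (y y' : Fin n → ℝ) :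
    ⟪slotSum k F.state (F.pull (coherent y)),
      rotate n o (slotSum k F.state (F.pull (coherent y')))⟫_ℂ =
    ∑ j, ∑ l, Complex.exp (((o : Matrix (Fin k) (Fin k) ℝ) j l * (y ⬝ᵥ y') : ℝ) : ℂ) := by
  rw [slotSum_coherent, slotSum_coherent, map_sum, sum_inner]
  refine Finset.sum_congr rfl fun j _ => ?_
  rw [inner_sum]
  refine Finset.sum_congr rfl fun l _ => ?_
  rw [F.rotate_tensor_coherent o ho, inner_tensor_coherent]
  congr 1
  rw [Finset.sum_eq_single j]
  · simp only [column, Matrix.of_apply, Matrix.mul_apply, Matrix.transpose_apply, dotProduct]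
    push_cast
    rw [Finset.mul_sum]
    refine Finset.sum_congr rfl fun i _ => ?_
    rw [Finset.sum_eq_single l (by intro b _ hb; simp [hb]) (by simp), if_pos rfl]
    ring
  · intro m _ hm
    simp [column, hm]
  · simp

theorem rotate_tensorPow_state {k : ℕ} (o : Matrix.orthogonalGroup (Fin k) ℝ)
    (ho : F.Fixes (o : Matrix (Fin k) (Fin k) ℝ)) :
    rotate n o (tensorPow k F.state) = tensorPow k F.state := by
  have := F.rotate_tensor_coherent o ho 0
  simp only [Matrix.zero_mul] at this
  exact this

end GaussianFrame

/-! ### The contraction of the sum over slots -/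

/-- The weight of degree `m` of the combination `∑ c y • coherent y` over `y ∈ s`. -/
def degreeWeight {n : ℕ} (s : Finset (Fin n → ℝ)) (c : (Fin n → ℝ) → ℂ) (m : ℕ) : ℝ :=
  (∑ α : Fin m → Fin n, ‖∑ y ∈ s, c y * ∏ t, (y (α t) : ℂ)‖ ^ 2) / m.factorial

theorem degreeWeight_nonneg {n : ℕ} (s : Finset (Fin n → ℝ)) (c : (Fin n → ℝ) → ℂ) (m : ℕ) :
    0 ≤ degreeWeight s c m := by
  unfold degreeWeight; positivity

/-- Expanding (y·y')^m over index tuples exhibits the kernel of degree m as a sum of squares. -/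
theorem sum_sum_dotProduct_pow {n : ℕ} (s : Finset (Fin n → ℝ)) (c : (Fin n → ℝ) → ℂ) (m : ℕ) :
    ∑ y ∈ s, ∑ y' ∈ s, conj (c y) * c y' * (((y ⬝ᵥ y' : ℝ) : ℂ) ^ m / m.factorial) =
      (degreeWeight s c m : ℂ) := by
  have h1 : ∀ y y' : Fin n → ℝ, ((y ⬝ᵥ y' : ℝ) : ℂ) ^ m =
      ∑ α : Fin m → Fin n, (∏ t, (y (α t) : ℂ)) * ∏ t, (y' (α t) : ℂ) := fun y y' => by
    simp only [dotProduct, Complex.ofReal_sum, Complex.ofReal_mul]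
    rw [Fintype.sum_pow]
    exact Finset.sum_congr rfl fun α _ => Finset.prod_mul_distrib
  have h2 : ∀ α : Fin m → Fin n, ((‖∑ y ∈ s, c y * ∏ t, (y (α t) : ℂ)‖ ^ 2 : ℝ) : ℂ) =
      ∑ y ∈ s, ∑ y' ∈ s, conj (c y) * c y' * ((∏ t, (y (α t) : ℂ)) * ∏ t, (y' (α t) : ℂ)) := by
    intro α
    rw [Complex.ofReal_pow, ← Complex.conj_mul', map_sum, Finset.sum_mul_sum]
    refine Finset.sum_congr rfl fun y _ => Finset.sum_congr rfl fun y' _ => ?_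
    simp only [map_mul, map_prod, Complex.conj_ofReal]
    ring
  rw [degreeWeight, Complex.ofReal_div, Complex.ofReal_sum, Complex.ofReal_natCast]
  simp only [h1, h2, Finset.sum_div, Finset.mul_sum, mul_div_assoc]
  symm
  rw [Finset.sum_comm]
  refine Finset.sum_congr rfl fun y _ => ?_
  rw [Finset.sum_comm]

/-- Scaling y·y' by r multiplies degree m by r^m, so a rotation acts on the weights only through
power sums of its entries. -/
theorem hasSum_degreeWeight {n : ℕ} (s : Finset (Fin n → ℝ)) (c : (Fin n → ℝ) → ℂ) (r : ℝ) :
    HasSum (fun m => ((r ^ m * degreeWeight s c m : ℝ) : ℂ))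
      (∑ y ∈ s, ∑ y' ∈ s, conj (c y) * c y' * Complex.exp ((r * (y ⬝ᵥ y') : ℝ) : ℂ)) := by
  have h : HasSum (fun m => ∑ y ∈ s, ∑ y' ∈ s, conj (c y) * c y' *
      (((r * (y ⬝ᵥ y') : ℝ) : ℂ) ^ m / m.factorial))
      (∑ y ∈ s, ∑ y' ∈ s, conj (c y) * c y' * Complex.exp ((r * (y ⬝ᵥ y') : ℝ) : ℂ)) := by
    refine hasSum_sum fun y _ => hasSum_sum fun y' _ => HasSum.mul_left _ ?_
    rw [Complex.exp_eq_exp_ℂ]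
    exact NormedSpace.expSeries_div_hasSum_exp _
  convert h using 1
  ext1 m
  rw [Complex.ofReal_mul, ← sum_sum_dotProduct_pow, Finset.mul_sum]
  refine Finset.sum_congr rfl fun y _ => ?_
  rw [Finset.mul_sum]
  refine Finset.sum_congr rfl fun y' _ => ?_
  push_cast
  ring

namespace GaussianFrame

variable {n : ℕ} (F : GaussianFrame n)

/-- The weight of a vector in the components of degree at most two. -/
def lowWeight (χ : Modes n) : ℝ :=
  ‖⟪F.state, χ⟫_ℂ‖ ^ 2 + ∑ i, ‖⟪F.pull (hermiteOne i), χ⟫_ℂ‖ ^ 2 +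
    (∑ i, ∑ j, ‖⟪F.pull (hermiteTwo i j), χ⟫_ℂ‖ ^ 2) / 2

/-- The division by 2 in `lowWeight` is the 1/2! of degree two: ordered pairs (i, j) are the index
tuples of length 2. -/
theorem lowWeight_sum (s : Finset (Fin n → ℝ)) (c : (Fin n → ℝ) → ℂ) :
    F.lowWeight (∑ y ∈ s, c y • F.pull (coherent y)) =
      degreeWeight s c 0 + degreeWeight s c 1 + degreeWeight s c 2 := by
  have h0 : ⟪F.state, ∑ y ∈ s, c y • F.pull (coherent y)⟫_ℂ = ∑ y ∈ s, c y := by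
    rw [inner_sum]
    refine Finset.sum_congr rfl fun y _ => ?_
    rw [inner_smul_right, state, LinearIsometry.inner_map_map, inner_coherent]
    simp
  have h1 : ∀ i, ‖⟪F.pull (hermiteOne i), ∑ y ∈ s, c y • F.pull (coherent y)⟫_ℂ‖ =
      ‖∑ y ∈ s, c y * y i‖ := fun i => by
    rw [← one_mul ‖∑ y ∈ s, c y * (y i : ℂ)‖, ← Complex.norm_I, ← norm_mul, inner_sum,
      Finset.mul_sum]
    congr 1
    refine Finset.sum_congr rfl fun y _ => ?_
    rw [inner_smul_right, LinearIsometry.inner_map_map, inner_hermiteOne_coherent]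
    ring
  have h2 : ∀ i j, ‖⟪F.pull (hermiteTwo i j), ∑ y ∈ s, c y • F.pull (coherent y)⟫_ℂ‖ =
      ‖∑ y ∈ s, c y * (y i * y j)‖ := fun i j => by
    rw [← norm_neg (∑ y ∈ s, c y * (y i * y j : ℂ)), inner_sum, ← Finset.sum_neg_distrib]
    congr 1
    refine Finset.sum_congr rfl fun y _ => ?_
    rw [inner_smul_right, LinearIsometry.inner_map_map, inner_hermiteTwo_coherent]
    ring
  simp only [lowWeight, h0, h1, h2, degreeWeight]
  congr 1
  · congr 1
    · simp
    · rw [← (Equiv.funUnique (Fin 1) (Fin n)).symm.sum_comp]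
      simp
  · rw [← (finTwoArrowEquiv (Fin n)).symm.sum_comp, Fintype.sum_prod_type]
    simp

theorem re_inner_slotSum_sum_le {k : ℕ} (o : Matrix.orthogonalGroup (Fin k) ℝ)
    (ho : F.Fixes (o : Matrix (Fin k) (Fin k) ℝ)) {r : ℝ} (hr : 0 ≤ r)
    (hor : ∀ m, 3 ≤ m → ∑ j, ∑ l, (o : Matrix (Fin k) (Fin k) ℝ) j l ^ m ≤ r)
    (s : Finset (Fin n → ℝ)) (c : (Fin n → ℝ) → ℂ) :
    (⟪slotSum k F.state (∑ y ∈ s, c y • F.pull (coherent y)),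
      rotate n o (slotSum k F.state (∑ y ∈ s, c y • F.pull (coherent y)))⟫_ℂ).re ≤
    r * ‖∑ y ∈ s, c y • F.pull (coherent y)‖ ^ 2 +
      k ^ 2 * F.lowWeight (∑ y ∈ s, c y • F.pull (coherent y)) := by
  set R := (o : Matrix (Fin k) (Fin k) ℝ) with hR
  -- Entries of an orthogonal matrix are at most 1 in modulus. This crude bound serves the degrees
  -- below 3, whose weight will be negligible.
  have hle : ∀ m, ∑ j, ∑ l, R j l ^ m ≤ (k : ℝ) ^ 2 := fun m => by
    have : ∀ j l, R j l ^ m ≤ 1 := fun j l =>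
      (le_abs_self _).trans (by
        rw [abs_pow]
        exact pow_le_one₀ (abs_nonneg _) (entry_norm_bound_of_unitary o.2 j l))
    calc ∑ j, ∑ l, R j l ^ m ≤ ∑ _j : Fin k, ∑ _l : Fin k, (1 : ℝ) :=
          Finset.sum_le_sum fun j _ => Finset.sum_le_sum fun l _ => this j l
      _ = (k : ℝ) ^ 2 := by simp [sq]
  have hnorm : HasSum (fun m => degreeWeight s c m)
      (‖∑ y ∈ s, c y • F.pull (coherent y)‖ ^ 2) := by
    have h := hasSum_degreeWeight s c 1
    simp only [one_pow, one_mul] at h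
    have e : ∑ y ∈ s, ∑ y' ∈ s, conj (c y) * c y' * Complex.exp ((y ⬝ᵥ y' : ℝ) : ℂ) =
        ((‖∑ y ∈ s, c y • F.pull (coherent y)‖ ^ 2 : ℝ) : ℂ) := by
      rw [Complex.ofReal_pow]
      refine Eq.trans ?_
        (inner_self_eq_norm_sq_to_K (𝕜 := ℂ) (∑ y ∈ s, c y • F.pull (coherent y)))
      rw [sum_inner]
      refine Finset.sum_congr rfl fun y _ => ?_
      rw [inner_sum]
      refine Finset.sum_congr rfl fun y' _ => ?_
      rw [inner_smul_left, inner_smul_right, LinearIsometry.inner_map_map, inner_coherent, mul_assoc]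
      simp [dotProduct]
    rw [e] at h
    exact_mod_cast h
  have hrot : HasSum (fun m => (∑ j, ∑ l, R j l ^ m) * degreeWeight s c m)
      (⟪slotSum k F.state (∑ y ∈ s, c y • F.pull (coherent y)),
        rotate n o (slotSum k F.state (∑ y ∈ s, c y • F.pull (coherent y)))⟫_ℂ).re := by
    have h : HasSum (fun m => ∑ j, ∑ l, ((R j l ^ m * degreeWeight s c m : ℝ) : ℂ)) _ :=
      hasSum_sum fun j _ => hasSum_sum fun l _ => hasSum_degreeWeight s c (R j l)
    have e : ⟪slotSum k F.state (∑ y ∈ s, c y • F.pull (coherent y)),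
        rotate n o (slotSum k F.state (∑ y ∈ s, c y • F.pull (coherent y)))⟫_ℂ =
        ∑ j, ∑ l, ∑ y ∈ s, ∑ y' ∈ s, conj (c y) * c y' *
          Complex.exp ((R j l * (y ⬝ᵥ y') : ℝ) : ℂ) := by
      have e1 : slotSum k F.state (∑ y ∈ s, c y • F.pull (coherent y)) =
          ∑ y ∈ s, c y • slotSum k F.state (F.pull (coherent y)) := by
        simp only [map_sum, map_smul]
      have e2 : ⟪slotSum k F.state (∑ y ∈ s, c y • F.pull (coherent y)),
          rotate n o (slotSum k F.state (∑ y ∈ s, c y • F.pull (coherent y)))⟫_ℂ =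
          ∑ y ∈ s, ∑ y' ∈ s, ∑ j, ∑ l, conj (c y) * c y' *
            Complex.exp ((R j l * (y ⬝ᵥ y') : ℝ) : ℂ) := by
        rw [e1, map_sum, sum_inner]
        refine Finset.sum_congr rfl fun y _ => ?_
        rw [inner_sum]
        refine Finset.sum_congr rfl fun y' _ => ?_
        rw [map_smul, inner_smul_left, inner_smul_right, F.inner_slotSum_rotate_slotSum o ho,
          ← mul_assoc]
        simp only [Finset.mul_sum, hR]
      rw [e2]
      refine (Finset.sum_congr rfl fun y _ => Finset.sum_comm).trans (Finset.sum_comm.trans ?_)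
      exact Finset.sum_congr rfl fun j _ =>
        (Finset.sum_congr rfl fun y _ => Finset.sum_comm).trans Finset.sum_comm
    rw [← e] at h
    have h2 := Complex.hasSum_re h
    simp only [← Complex.ofReal_sum, Complex.ofReal_re, ← Finset.sum_mul] at h2
    exact h2
  have hlow : HasSum (fun m => if m < 3 then degreeWeight s c m else 0)
      (F.lowWeight (∑ y ∈ s, c y • F.pull (coherent y))) := by
    rw [lowWeight_sum]
    have : HasSum (fun m => if m < 3 then degreeWeight s c m else 0)
        (∑ m ∈ Finset.range 3, if m < 3 then degreeWeight s c m else 0) :=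
      hasSum_sum_of_ne_finset_zero fun m hm => if_neg (by simpa using hm)
    simpa [Finset.sum_range_succ] using this
  refine hasSum_le (fun m => ?_) hrot ((hnorm.mul_left r).add (hlow.mul_left ((k : ℝ) ^ 2)))
  have hd := degreeWeight_nonneg s c m
  split_ifs with hm
  · have := mul_le_mul_of_nonneg_right (hle m) hd
    have := mul_nonneg hr hd
    linarith
  · have := mul_le_mul_of_nonneg_right (hor m (not_lt.1 hm)) hd
    linarith

/-- The rotation contracts the sum over slots of a vector without components of low degree. -/
theorem re_inner_slotSum_le {k : ℕ} (o : Matrix.orthogonalGroup (Fin k) ℝ)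
    (ho : F.Fixes (o : Matrix (Fin k) (Fin k) ℝ)) {r : ℝ} (hr : 0 ≤ r)
    (hor : ∀ m, 3 ≤ m → ∑ j, ∑ l, (o : Matrix (Fin k) (Fin k) ℝ) j l ^ m ≤ r) (χ : Modes n) :
    (⟪slotSum k F.state χ, rotate n o (slotSum k F.state χ)⟫_ℂ).re ≤
      r * ‖χ‖ ^ 2 + k ^ 2 * F.lowWeight χ := by
  have hc : Continuous (slotSum k F.state) :=
    AddMonoidHomClass.continuous_of_bound _ k (norm_slotSum_le k F.norm_state)
  -- Both sides are continuous in χ, so density of the span of coherent states reduces the claim to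
  -- finite combinations.
  have hcl : IsClosed {χ | (⟪slotSum k F.state χ, rotate n o (slotSum k F.state χ)⟫_ℂ).re ≤
      r * ‖χ‖ ^ 2 + k ^ 2 * F.lowWeight χ} := by
    refine isClosed_le ?_ ?_
    · exact Complex.continuous_re.comp (hc.inner ((rotate n o).continuous.comp hc))
    · unfold lowWeight
      fun_prop
  have hsub : ((Submodule.span ℂ (Set.range fun y => F.pull (coherent y)) : Submodule ℂ (Modes n)) :
      Set (Modes n)) ⊆ {χ | (⟪slotSum k F.state χ, rotate n o (slotSum k F.state χ)⟫_ℂ).re ≤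
      r * ‖χ‖ ^ 2 + k ^ 2 * F.lowWeight χ} := by
    intro χ hχ
    obtain ⟨c, rfl⟩ := Finsupp.mem_span_range_iff_exists_finsupp.1 hχ
    exact F.re_inner_slotSum_sum_le o ho hr hor c.support c
  have hmem : χ ∈ (Submodule.span ℂ (Set.range fun y => F.pull (coherent y))).topologicalClosure := by
    rw [F.dense_span_coherent]; trivial
  exact hcl.closure_subset_iff.2 hsub hmem

end GaussianFrame

namespace GaussianFrame

variable {n : ℕ} (F : GaussianFrame n)

/-! ### Lower bound for the change of a tensor power under a rotation -/

/-- With v the slot sum, ‖v‖² = k‖χ‖² and Re⟨v, U_o v⟩ ≤ (r + ½)‖χ‖², so ‖v − U_o v‖² ≥ (2k − 2r −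
1)‖χ‖² ≥ ‖χ‖². -/
theorem norm_sub_rotate_slotSum_ge {k : ℕ} (o : Matrix.orthogonalGroup (Fin k) ℝ)
    (ho : F.Fixes (o : Matrix (Fin k) (Fin k) ℝ)) {r : ℝ} (hr : 0 ≤ r) (hrk : r + 1 ≤ k)
    (hor : ∀ m, 3 ≤ m → ∑ j, ∑ l, (o : Matrix (Fin k) (Fin k) ℝ) j l ^ m ≤ r) {χ : Modes n}
    (hχ : ⟪F.state, χ⟫_ℂ = 0) (hlow : 2 * k ^ 2 * F.lowWeight χ ≤ ‖χ‖ ^ 2) :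
    ‖χ‖ ≤ ‖slotSum k F.state χ - rotate n o (slotSum k F.state χ)‖ := by
  have h1 := F.re_inner_slotSum_le o ho hr hor χ
  have h2 := norm_sq_slotSum k F.norm_state hχ
  have h3 := @norm_sub_sq ℂ _ _ _ _ (slotSum k F.state χ) (rotate n o (slotSum k F.state χ))
  rw [LinearIsometry.norm_map, h2] at h3
  have h4 : r * ‖χ‖ ^ 2 + ‖χ‖ ^ 2 ≤ k * ‖χ‖ ^ 2 := by
    have := mul_le_mul_of_nonneg_right hrk (sq_nonneg ‖χ‖)
    linarith
  have h5 : RCLike.re ⟪slotSum k F.state χ, rotate n o (slotSum k F.state χ)⟫_ℂ =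
    (⟪slotSum k F.state χ, rotate n o (slotSum k F.state χ)⟫_ℂ).re := rfl
  rw [h5] at h3
  refine le_of_sq_le_sq ?_ (norm_nonneg _)
  linarith

/-- As k ≤ 3, |α|^{k−1} ≥ |α|² ≥ ¾, so the first-order term moves by at least ¾‖χ‖. The remainder
moves by at most 16‖χ‖² ≤ ¼‖χ‖. -/
theorem norm_tensorPow_sub_rotate_ge {k : ℕ} (hk : 1 ≤ k) (hk3 : k ≤ 3)
    (o : Matrix.orthogonalGroup (Fin k) ℝ) (ho : F.Fixes (o : Matrix (Fin k) (Fin k) ℝ)) {r : ℝ}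
    (hr : 0 ≤ r) (hrk : r + 1 ≤ k)
    (hor : ∀ m, 3 ≤ m → ∑ j, ∑ l, (o : Matrix (Fin k) (Fin k) ℝ) j l ^ m ≤ r) {ψ : Modes n}
    (hψ : ‖ψ‖ = 1)
    (hlow : 2 * k ^ 2 * F.lowWeight (ψ - ⟪F.state, ψ⟫_ℂ • F.state) ≤
      ‖ψ - ⟪F.state, ψ⟫_ℂ • F.state‖ ^ 2)
    (hsmall : ‖ψ - ⟪F.state, ψ⟫_ℂ • F.state‖ ≤ 1 / 64) :
    ‖ψ - ⟪F.state, ψ⟫_ℂ • F.state‖ / 4 ≤ ‖tensorPow k ψ - rotate n o (tensorPow k ψ)‖ := by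
  set α := ⟪F.state, ψ⟫_ℂ with hα
  set χ := ψ - α • F.state with hχ
  have horth : ⟪F.state, χ⟫_ℂ = 0 := by
    rw [hχ, inner_sub_right, inner_smul_right, inner_self_eq_norm_sq_to_K, F.norm_state, ← hα]
    simp
  have hdec : ψ = χ + α • F.state := by rw [hχ]; abel
  have hpyth : ‖χ‖ ^ 2 + ‖α‖ ^ 2 = 1 := by
    have h := @norm_add_sq ℂ _ _ _ _ χ (α • F.state)
    rw [← hdec, hψ, inner_smul_right, ← inner_conj_symm, horth, norm_smul, F.norm_state] at h
    simp at h
    linarith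
  have hα1 : ‖α‖ ≤ 1 := by
    have := sq_nonneg ‖χ‖
    exact (sq_le_one_iff₀ (norm_nonneg _)).1 (by linarith)
  have hα2 : 3 / 4 ≤ ‖α ^ (k - 1)‖ := by
    have h1 : ‖α‖ ^ 2 ≤ ‖α‖ ^ (k - 1) :=
      pow_le_pow_of_le_one (norm_nonneg _) hα1 (by omega)
    rw [norm_pow]
    nlinarith [norm_nonneg χ]
  have hv := F.norm_sub_rotate_slotSum_ge o ho hr hrk hor horth hlow
  set v := slotSum k F.state χ with hvdef
  set e := tensorPow k ψ - (α ^ k • tensorPow k F.state + α ^ (k - 1) • v) with he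
  have hele : ‖e‖ ≤ 8 * ‖χ‖ ^ 2 := by
    have h := norm_tensorPow_sub_le k F.norm_state hα1 (hsmall.trans (by norm_num))
    rw [← hdec] at h
    refine h.trans (mul_le_mul_of_nonneg_right ?_ (sq_nonneg _))
    calc (2 : ℝ) ^ k ≤ 2 ^ 3 := pow_le_pow_right₀ (by norm_num) hk3
      _ = 8 := by norm_num
  have hsplit : tensorPow k ψ - rotate n o (tensorPow k ψ) =
      α ^ (k - 1) • (v - rotate n o v) + (e - rotate n o e) := by
    have h1 : tensorPow k ψ = α ^ k • tensorPow k F.state + α ^ (k - 1) • v + e := by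
      rw [he]; abel
    rw [h1, map_add, map_add, map_smul, map_smul, F.rotate_tensorPow_state o ho, smul_sub]
    abel
  have h1 : ‖e - rotate n o e‖ ≤ 2 * ‖e‖ := by
    refine (norm_sub_le _ _).trans ?_
    rw [LinearIsometry.norm_map]
    linarith
  have h2 := norm_sub_le_norm_add (α ^ (k - 1) • (v - rotate n o v)) (e - rotate n o e)
  rw [norm_smul] at h2
  have h3 : 3 / 4 * ‖χ‖ ≤ ‖α ^ (k - 1)‖ * ‖v - rotate n o v‖ :=
    mul_le_mul hα2 hv (norm_nonneg _) (norm_nonneg _)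
  rw [hsplit]
  have h4 : ‖χ‖ ^ 2 ≤ 1 / 64 * ‖χ‖ := by
    rw [sq]; exact mul_le_mul_of_nonneg_right hsmall (norm_nonneg _)
  linarith [norm_nonneg χ]

/-! ### Almost optimal Gaussian states -/

/-- The perturbations of the Gaussian state by `exp (t ω q)` stay in `P`, up to a scalar. -/
def StaysIn (P : Set (Modes n)) (q : (Fin n → ℝ) → ℂ) : Prop :=
  ∀ ω : ℂ, ‖ω‖ = 1 → ∀ t : ℝ, 0 ≤ t → t ≤ 1 / 16 →
    ∃ (κ : ℂ), ∃ φ ∈ P, F.pull (vacMul fun u => Complex.exp (t * (ω * q u))) = κ • φ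

end GaussianFrame

/-- Pulling back to the vacuum by an isometry makes one δ valid for all frames, families and states,
as is needed when the near-minimizer is chosen after δ. -/
theorem exists_forall_norm_inner_le (n : ℕ) {η : ℝ} (hη : 0 < η) :
    ∃ δ : ℝ, 0 < δ ∧ ∀ (F : GaussianFrame n) (P : Set (Modes n)) (ψ : Modes n) (M : ℝ)
      (q : (Fin n → ℝ) → ℂ), (∀ φ ∈ P, ‖φ‖ = 1) → ‖ψ‖ = 1 → Continuous q →
      (∀ u, ‖q u‖ ≤ 1 + sqNorm u) → F.StaysIn P q → (∀ φ ∈ P, ‖⟪φ, ψ⟫_ℂ‖ ^ 2 ≤ M) →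
      M - δ ≤ ‖⟪F.state, ψ⟫_ℂ‖ ^ 2 →
      ‖⟪F.state, ψ⟫_ℂ‖ * ‖⟪F.pull (vacMul q), ψ - ⟪F.state, ψ⟫_ℂ • F.state⟫_ℂ‖ ≤ η := by
  obtain ⟨C, hC, hCle⟩ := exists_norm_vacMul_exp_sub_le n
  obtain ⟨K, hK, hKle⟩ := exists_norm_vacMul_le n
  obtain ⟨δ, hδ, H⟩ := exists_forall_re_inner_le_of_almost_maximal (H := Modes n) C (1 / 16) (4 * K)
    η hC (by norm_num) (by positivity) hη
  refine ⟨δ, hδ, fun F P ψ M q hP hψ hq hqle hstay hM hδM => ?_⟩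
  set α := ⟪F.state, ψ⟫_ℂ with hα
  set D := ⟪F.pull (vacMul q), ψ - α • F.state⟫_ℂ with hD
  have sq : SlowGrowth q := .of_le hq (C := 1) (by simpa using hqle)
  -- The one-sided bound on a real part holds for every phase ω; aligning ω with conj α · D turns it
  -- into a bound on the modulus.
  have key : ∀ ω : ℂ, ‖ω‖ = 1 → (conj α * (conj ω * D)).re ≤ η := by
    intro ω hω
    have hωq : Continuous fun u => ω * q u := by fun_prop
    have hωle : ∀ u, ‖ω * q u‖ ≤ 1 + sqNorm u := fun u => by
      rw [norm_mul, hω, one_mul]; exact hqle u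
    have h := H F.state (F.pull (vacMul fun u => ω * q u)) ψ
      (fun t => F.pull (vacMul fun u => Complex.exp (t * (ω * q u)))) M F.norm_state (by
        rw [LinearIsometry.norm_map]
        refine hKle _ 4 hωq fun u => (hωle u).trans ?_
        have := Real.add_one_le_exp (sqNorm u / 4)
        have := sqNorm_nonneg u
        linarith) hψ (fun t ht ht1 => by
        rw [GaussianFrame.state, ← map_smul, ← map_add, ← map_sub, LinearIsometry.norm_map]
        exact hCle _ hωq hωle t ht ht1) (fun t ht ht1 => by
        obtain ⟨κ, φ, hφ, h⟩ := hstay ω hω t ht ht1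
        rw [h, inner_smul_left, norm_mul, norm_smul, hP φ hφ, RCLike.norm_conj, mul_pow, mul_one]
        exact mul_le_mul_of_nonneg_left (hM φ hφ) (sq_nonneg _)) hδM
    rwa [vacMul_const_mul sq, map_smul, inner_smul_left] at h
  rcases eq_or_ne (conj α * D) 0 with h0 | h0
  · have : ‖α‖ * ‖D‖ = 0 := by rw [← RCLike.norm_conj α, ← norm_mul, h0, norm_zero]
    linarith
  · have hn : (‖conj α * D‖ : ℂ) ≠ 0 := by simpa using h0
    have h := key (conj α * D / ‖conj α * D‖) (by
      rw [norm_div, Complex.norm_real, norm_norm, div_self (norm_ne_zero_iff.2 h0)])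
    have e : conj α * (conj (conj α * D / ‖conj α * D‖) * D) = ‖conj α * D‖ := by
      rw [mul_left_comm, map_div₀, Complex.conj_ofReal, div_mul_eq_mul_div, Complex.conj_mul',
        pow_two, mul_div_assoc, div_self hn, mul_one]
    rw [e, Complex.ofReal_re, norm_mul, RCLike.norm_conj] at h
    exact h

theorem hermiteOne_eq {n : ℕ} (k : Fin n) :
    hermiteOne k = (√2 : ℂ) • vacMul fun u : Fin n → ℝ => (u k : ℂ) :=
  vacMul_const_mul (slowGrowth_coord k) _

theorem hermiteTwo_eq {n : ℕ} (k l : Fin n) :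
    hermiteTwo k l = (2 : ℂ) • vacMul (fun u : Fin n → ℝ => (u k * u l : ℂ)) +
      (if l = k then (-1 : ℂ) else 0) • coherent 0 := by
  rw [hermiteTwo, vacMul_add ((slowGrowth_coord_mul_coord k l).const_mul 2)
    ((slowGrowth_one n).const_mul _), vacMul_const_mul (slowGrowth_coord_mul_coord k l),
    vacMul_const_mul (slowGrowth_one n), coherent_zero]

namespace GaussianFrame

variable {n : ℕ} (F : GaussianFrame n)

theorem lowWeight_le {χ : Modes n} {η : ℝ} (hχ : ⟪F.state, χ⟫_ℂ = 0)
    (h1 : ∀ k, ‖⟪F.pull (vacMul fun u => (u k : ℂ)), χ⟫_ℂ‖ ≤ η)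
    (h2 : ∀ k l, ‖⟪F.pull (vacMul fun u => (u k * u l : ℂ)), χ⟫_ℂ‖ ≤ η) :
    F.lowWeight χ ≤ 2 * (n + 1) ^ 2 * η ^ 2 := by
  have e1 : ∀ k, ‖⟪F.pull (hermiteOne k), χ⟫_ℂ‖ ^ 2 ≤ 2 * η ^ 2 := fun k => by
    rw [hermiteOne_eq, map_smul, inner_smul_left, norm_mul, RCLike.norm_conj, mul_pow,
      Complex.norm_real, Real.norm_of_nonneg (Real.sqrt_nonneg _), Real.sq_sqrt (by norm_num)]
    have := pow_le_pow_left₀ (norm_nonneg _) (h1 k) 2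
    linarith
  have e2 : ∀ k l, ‖⟪F.pull (hermiteTwo k l), χ⟫_ℂ‖ ^ 2 ≤ 4 * η ^ 2 := fun k l => by
    have hχ' : ⟪F.pull (coherent 0), χ⟫_ℂ = 0 := hχ
    rw [hermiteTwo_eq, map_add, map_smul, map_smul, inner_add_left, inner_smul_left,
      inner_smul_left, hχ', mul_zero, add_zero, norm_mul, RCLike.norm_conj, mul_pow]
    have := pow_le_pow_left₀ (norm_nonneg _) (h2 k l) 2
    norm_num
    linarith
  have s1 : ∑ k, ‖⟪F.pull (hermiteOne k), χ⟫_ℂ‖ ^ 2 ≤ n * (2 * η ^ 2) :=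
    (Finset.sum_le_sum fun k _ => e1 k).trans (by simp)
  have s2 : ∑ k, ∑ l, ‖⟪F.pull (hermiteTwo k l), χ⟫_ℂ‖ ^ 2 ≤ n * (n * (4 * η ^ 2)) :=
    (Finset.sum_le_sum fun k _ => Finset.sum_le_sum fun l _ => e2 k l).trans (by simp)
  rw [lowWeight, hχ]
  simp only [norm_zero]
  have h0 : 0 ≤ n * η ^ 2 := by positivity
  have h3 : 0 ≤ η ^ 2 := by positivity
  nlinarith

theorem stays_in_coord_mul_coord {P : Set (Modes n)}
    (hP : ∀ φ, IsGaussianWithMean F.a F.p φ → φ ∈ P) (k l : Fin n) :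
    F.StaysIn P fun u => (u k * u l : ℂ) := by
  intro ω hω t ht ht1
  obtain ⟨κ, φ, h1, h2⟩ := F.exists_pull_vacMul_exp_coord_mul_coord hω.le k l ht ht1
    (slowGrowth_exp_mul (q := fun u => ω * (u k * u l)) (by fun_prop) (fun u => by
      have := norm_coord_mul_coord_le u k l
      rw [norm_mul, hω]
      linarith) ht ht1)
  exact ⟨κ, φ, hP φ h1, h2⟩

theorem stays_in_coord (k : Fin n) : F.StaysIn (gaussianStates n) fun u => (u k : ℂ) := by
  intro ω hω t ht ht1
  obtain ⟨κ, a, p, φ, h1, h2⟩ := F.exists_pull_vacMul_exp_coord ω k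
    (slowGrowth_exp_mul (q := fun u => ω * u k) (by fun_prop) (fun u => by
      rw [norm_mul, hω, one_mul]
      exact norm_coord_le u k) ht ht1)
  exact ⟨κ, φ, ⟨a, p, h1⟩, h2⟩

/-- Odd against even. In the zero-mean case this replaces optimality in degree one, since linear
deformations leave the family. -/
theorem inner_pull_coord_eq_zero_of_isEven (ha : F.a = 0) (hp : F.p = 0) {ψ : Modes n}
    (hψ : IsEven ψ) (k : Fin n) :
    ⟪F.pull (vacMul fun u => (u k : ℂ)), ψ - ⟪F.state, ψ⟫_ℂ • F.state⟫_ℂ = 0 := by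
  have h1 : ⟪F.pull (vacMul fun u => (u k : ℂ)), F.state⟫_ℂ = 0 := by
    have := inner_hermiteOne_coherent k 0
    rw [hermiteOne_eq, inner_smul_left] at this
    rw [state, LinearIsometry.inner_map_map]
    simpa using this
  have h2 : ⟪F.pull (vacMul fun u => (u k : ℂ)), ψ⟫_ℂ = 0 := by
    have hodd : ∀ x, F.wave (-x) * (F.coord (-x) k : ℂ) = -(F.wave x * F.coord x k) := fun x => by
      simp only [coord, wave, gaussianWave_eq, ha, hp, sub_zero, Matrix.mulVec_neg, neg_dotProduct,
        dotProduct_neg, neg_neg, Pi.neg_apply, zero_dotProduct, neg_zero, Complex.ofReal_neg]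
      ring
    have hae := F.coeFn_pull_vacMul (slowGrowth_coord k)
    have hneg : Measure.QuasiMeasurePreserving (fun x : Fin n → ℝ => -x) volume volume :=
      (Measure.measurePreserving_neg volume).quasiMeasurePreserving
    rw [L2.inner_def]
    have e : ∫ x, ⟪F.pull (vacMul fun u => (u k : ℂ)) (-x), ψ (-x)⟫_ℂ =
        ∫ x, -⟪F.pull (vacMul fun u => (u k : ℂ)) x, ψ x⟫_ℂ := by
      refine integral_congr_ae ?_
      filter_upwards [hae, hneg.ae_eq_comp hae, hψ] with x h1 h2 h3
      simp only [Function.comp_apply] at h2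
      rw [h1, h2, h3, hodd, inner_neg_left]
    rw [integral_neg_eq_self (fun x => ⟪F.pull (vacMul fun u => (u k : ℂ)) x, ψ x⟫_ℂ) volume,
      integral_neg] at e
    exact self_eq_neg.1 e
  rw [inner_sub_right, inner_smul_right, h1, h2]
  simp

end GaussianFrame

/-! ### The tests -/

theorem distTo_nonneg {n : ℕ} (P : Set (Modes n)) (ψ : Modes n) : 0 ≤ distTo P ψ :=
  Real.iInf_nonneg fun _ => div_nonneg ENNReal.toReal_nonneg zero_le_two

/-- The common lower bound for all tests: `P` is a family of Gaussian states whose `k`-fold tensor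
powers are invariant under `o`. -/
theorem norm_tensorPow_sub_rotate_ge_of_distTo {n k : ℕ} (hk : 1 ≤ k) (hk3 : k ≤ 3)
    (o : Matrix.orthogonalGroup (Fin k) ℝ) {r : ℝ} (hr : 0 ≤ r) (hrk : r + 1 ≤ k)
    (hor : ∀ m, 3 ≤ m → ∑ j, ∑ l, (o : Matrix (Fin k) (Fin k) ℝ) j l ^ m ≤ r)
    {P : Set (Modes n)} [Nonempty P] {ψ : Modes n} (hψ : ‖ψ‖ = 1)
    (hP : ∀ φ ∈ P, ‖φ‖ = 1)
    (hF : ∀ φ ∈ P, ∃ F : GaussianFrame n, F.state = φ ∧ F.Fixes (o : Matrix (Fin k) (Fin k) ℝ) ∧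
      (∀ i j, F.StaysIn P fun u => (u i * u j : ℂ)) ∧
      ∀ i, F.StaysIn P (fun u => (u i : ℂ)) ∨
        ⟪F.pull (vacMul fun u => (u i : ℂ)), ψ - ⟪F.state, ψ⟫_ℂ • F.state⟫_ℂ = 0)
    (hε : distTo P ψ ≤ 1 / 128) :
    distTo P ψ / 4 ≤ ‖tensorPow k ψ - rotate n o (tensorPow k ψ)‖ := by
  set ε := distTo P ψ with hεdef
  have hε0 : 0 ≤ ε := distTo_nonneg P ψ
  -- The tolerance η is proportional to ε and must be positive.
  rcases hε0.eq_or_lt with h0 | hεpos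
  · rw [← h0]; simp
  have hn1 : (0 : ℝ) < n + 1 := by positivity
  -- Chosen so that the low weight is at most 2(n+1)²(2η)² = ε²/32; times 2k² ≤ 18 this is still
  -- below ε² ≤ ‖χ‖². The factor 2 in 2η comes from dividing by |α| ≥ ½.
  set η : ℝ := ε / (16 * (n + 1)) with hη
  have hηpos : 0 < η := by positivity
  obtain ⟨δ, hδ, H⟩ := exists_forall_norm_inner_le n hηpos
  have hdist : ∀ φ ∈ P, traceDist (density ψ) (density φ) = √(1 - ‖⟪φ, ψ⟫_ℂ‖ ^ 2) := fun φ hφ => by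
    rw [traceDist_density hψ (hP φ hφ), norm_inner_symm]
  have hbdd : BddBelow (Set.range fun φ : P => traceDist (density ψ) (density (φ : Modes n))) :=
    ⟨0, by rintro _ ⟨φ, rfl⟩; exact div_nonneg ENNReal.toReal_nonneg zero_le_two⟩
  have hup : ∀ φ ∈ P, ‖⟪φ, ψ⟫_ℂ‖ ^ 2 ≤ 1 - ε ^ 2 := fun φ hφ => by
    have h : ε ≤ √(1 - ‖⟪φ, ψ⟫_ℂ‖ ^ 2) := by
      rw [← hdist φ hφ]
      exact ciInf_le hbdd ⟨φ, hφ⟩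
    have := (Real.le_sqrt' hεpos).1 h
    linarith
  -- The bound by ε gives ‖χ‖ ≤ 2ε; the bound by δ gives (ε + ε')² ≤ ε² + δ, because ε ≤ 1/128.
  set ε' : ℝ := min ε δ with hε'
  have hε'pos : 0 < ε' := lt_min hεpos hδ
  obtain ⟨⟨φ, hφ⟩, hlt⟩ := exists_lt_of_ciInf_lt (show (⨅ φ : P, traceDist (density ψ)
    (density (φ : Modes n))) < ε + ε' from lt_add_of_pos_right ε hε'pos)
  simp only [hdist φ hφ] at hlt
  have hlow := (Real.sqrt_lt' (by positivity)).1 hlt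
  obtain ⟨F, rfl, hfix, hquad, hlin⟩ := hF φ hφ
  set α := ⟪F.state, ψ⟫_ℂ with hα
  set χ := ψ - α • F.state with hχ
  have horth : ⟪F.state, χ⟫_ℂ = 0 := by
    rw [hχ, inner_sub_right, inner_smul_right, inner_self_eq_norm_sq_to_K, F.norm_state, ← hα]
    simp
  have hpyth : ‖χ‖ ^ 2 = 1 - ‖α‖ ^ 2 := by
    have hdec : ψ = χ + α • F.state := by rw [hχ]; abel
    have h := @norm_add_sq ℂ _ _ _ _ χ (α • F.state)
    rw [← hdec, hψ, inner_smul_right, ← inner_conj_symm, horth, norm_smul, F.norm_state] at h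
    simp at h
    linarith
  have hχε : ε ≤ ‖χ‖ := by
    refine le_of_sq_le_sq ?_ (norm_nonneg _)
    have := hup _ hφ
    linarith
  have hχs : ‖χ‖ ≤ 1 / 64 := by
    have h1 : ε' ≤ ε := min_le_left _ _
    refine le_of_sq_le_sq ?_ (by norm_num)
    rw [hpyth]
    refine hlow.le.trans (pow_le_pow_left₀ (by positivity) ?_ 2)
    linarith
  have hMδ : 1 - ε ^ 2 - δ ≤ ‖α‖ ^ 2 := by
    have h1 : ε' ≤ ε := min_le_left _ _
    have h2 : ε' ≤ δ := min_le_right _ _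
    nlinarith
  have hαhalf : 1 / 2 ≤ ‖α‖ := by
    refine le_of_sq_le_sq ?_ (norm_nonneg _)
    nlinarith [norm_nonneg χ]
  have hsmall : ∀ q : (Fin n → ℝ) → ℂ, Continuous q → (∀ u, ‖q u‖ ≤ 1 + sqNorm u) →
      F.StaysIn P q → ‖⟪F.pull (vacMul q), χ⟫_ℂ‖ ≤ 2 * η := fun q hq hqle hst => by
    have h := H F P ψ (1 - ε ^ 2) q hP hψ hq hqle hst hup hMδ
    have := mul_le_mul_of_nonneg_right hαhalf (norm_nonneg ⟪F.pull (vacMul q), χ⟫_ℂ)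
    linarith
  have hweight := F.lowWeight_le (η := 2 * η) horth
    (fun i => (hlin i).elim
      (fun h => hsmall _ (by fun_prop) (fun u => norm_coord_le u i) h)
      (fun h => by rw [h, norm_zero]; positivity))
    (fun i j => hsmall _ (by fun_prop) (fun u => by
      have := norm_coord_mul_coord_le u i j
      linarith) (hquad i j))
  have hw : 2 * (k : ℝ) ^ 2 * F.lowWeight χ ≤ ‖χ‖ ^ 2 := by
    have hk9 : (k : ℝ) ^ 2 ≤ 9 := by
      have : (k : ℝ) ≤ 3 := by exact_mod_cast hk3
      nlinarith [(Nat.cast_nonneg k : (0 : ℝ) ≤ k)]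
    have hηe : 2 * (n + 1 : ℝ) ^ 2 * (2 * η) ^ 2 = ε ^ 2 / 32 := by
      rw [hη]; field_simp; norm_num
    rw [hηe] at hweight
    have h1 : 2 * (k : ℝ) ^ 2 * F.lowWeight χ ≤ 2 * (k : ℝ) ^ 2 * (ε ^ 2 / 32) :=
      mul_le_mul_of_nonneg_left hweight (by positivity)
    have h2 : (k : ℝ) ^ 2 * ε ^ 2 ≤ 9 * ε ^ 2 := mul_le_mul_of_nonneg_right hk9 (sq_nonneg _)
    have h3 : ε ^ 2 ≤ ‖χ‖ ^ 2 := pow_le_pow_left₀ hε0 hχε 2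
    have h4 := sq_nonneg ε
    linarith
  have := F.norm_tensorPow_sub_rotate_ge hk hk3 o hfix hr hrk hor hψ hw hχs
  linarith

theorem acceptProb_le_of_norm_ge {n k : ℕ} {S : Set (Matrix.orthogonalGroup (Fin k) ℝ)}
    {ψ : Modes n} (hψ : ‖ψ‖ = 1) {o : Matrix.orthogonalGroup (Fin k) ℝ} (ho : o ∈ S) {ε : ℝ}
    (hε0 : 0 ≤ ε) (hε : ε / 4 ≤ ‖tensorPow k ψ - rotate n o (tensorPow k ψ)‖) :
    acceptProb S ψ ≤ 1 - 1 / 64 * ε ^ 2 := by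
  have hn : ‖tensorPow k ψ‖ = 1 := by rw [← tensor_const, norm_tensor]; simp [hψ]
  have h := acceptProb_le hn ho
  have := pow_le_pow_left₀ (by positivity) hε 2
  linarith

/-! ### Power sums of the rotation entries, and the two kinds of test -/

/-- The entries are ±√2/2 with a single minus sign: the sum is √2/2 for m = 3 and at most 4·¼ from m
= 4 on. -/
theorem sum_rot2_pow_le (m : ℕ) (hm : 3 ≤ m) :
    ∑ j, ∑ l, (rot2 (Real.pi / 4) : Matrix (Fin 2) (Fin 2) ℝ) j l ^ m ≤ 1 := by
  have hc : (√2 / 2 : ℝ) ^ 2 = 1 / 2 := by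
    rw [div_pow, Real.sq_sqrt (by norm_num)]; norm_num
  have hc0 : 0 ≤ √2 / 2 := by positivity
  have hc1 : √2 / 2 ≤ 1 := by
    refine le_of_sq_le_sq ?_ zero_le_one
    rw [hc]; norm_num
  simp only [rot2, Fin.sum_univ_two, Real.cos_pi_div_four, Real.sin_pi_div_four]
  simp only [Matrix.of_apply, Matrix.cons_val', Matrix.cons_val_zero, Matrix.cons_val_one,
    Matrix.cons_val_fin_one]
  generalize √2 / 2 = x at *
  rcases hm.eq_or_lt with rfl | hm
  · have : (-x) ^ 3 = -(x ^ 3) := by ring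
    have h3 : x ^ 3 = x / 2 := by rw [pow_succ, hc]; ring
    linarith
  · have h4 : x ^ m ≤ 1 / 4 := by
      refine (pow_le_pow_of_le_one hc0 hc1 hm).trans ?_
      rw [show x ^ (3 + 1) = (x ^ 2) ^ 2 by ring, hc]
      norm_num
    have h5 : (-x) ^ m ≤ x ^ m := by
      refine (le_abs_self _).trans ?_
      rw [abs_pow, abs_neg, abs_of_nonneg hc0]
    linarith

theorem rot3_pi_div_three : (rot3 (Real.pi / 3) : Matrix (Fin 3) (Fin 3) ℝ) =
    !![2 / 3, -1 / 3, 2 / 3; 2 / 3, 2 / 3, -1 / 3; -1 / 3, 2 / 3, 2 / 3] := by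
  have h3 : √(3 : ℝ) * √3 = 3 := Real.mul_self_sqrt (by norm_num)
  simp only [rot3, Real.cos_pi_div_three, Real.sin_pi_div_three]
  ext i j
  fin_cases i <;> fin_cases j <;> simp <;> linarith

/-- The value 16/9 is 6·(2/3)³. The sum is 5/3 for m = 3 and at most 11/9 afterwards; any bound up
to 2 would serve. -/
theorem sum_rot3_pow_le (m : ℕ) (hm : 3 ≤ m) :
    ∑ j, ∑ l, (rot3 (Real.pi / 3) : Matrix (Fin 3) (Fin 3) ℝ) j l ^ m ≤ 16 / 9 := by
  rw [rot3_pi_div_three]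
  simp only [Fin.sum_univ_three, Matrix.of_apply, Matrix.cons_val', Matrix.cons_val_zero,
    Matrix.cons_val_one, Matrix.cons_val_fin_one, Matrix.cons_val]
  rcases hm.eq_or_lt with rfl | hm
  · norm_num
  · have h1 : (2 / 3 : ℝ) ^ m ≤ 16 / 81 :=
      (pow_le_pow_of_le_one (by norm_num) (by norm_num) hm).trans (by norm_num)
    have h2 : (-1 / 3 : ℝ) ^ m ≤ 1 / 81 := by
      refine (le_abs_self _).trans ?_
      rw [abs_pow]
      exact (pow_le_pow_of_le_one (abs_nonneg _) (by norm_num [abs_of_nonneg]) hm).trans (by norm_num)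
    linarith

theorem norm_sub_rotate_rot2_ge {n : ℕ} {ψ : Modes n} (hψ : ‖ψ‖ = 1) (heven : IsEven ψ)
    (hε : distTo (zeroMeanGaussianStates n) ψ ≤ 1 / 128) :
    distTo (zeroMeanGaussianStates n) ψ / 4 ≤
      ‖tensorPow 2 ψ - rotate n (rot2 (Real.pi / 4)) (tensorPow 2 ψ)‖ := by
  refine norm_tensorPow_sub_rotate_ge_of_distTo (r := 1) (by norm_num) (by norm_num) _ (by norm_num)
    (by norm_num) sum_rot2_pow_le hψ (fun φ hφ => hφ.norm_eq_one) (fun φ hφ => ?_) hε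
  obtain ⟨F, ha, hp, rfl⟩ := IsGaussianWithMean.exists_frame hφ
  refine ⟨F, rfl, Or.inr ⟨ha, hp⟩, F.stays_in_coord_mul_coord fun φ h => ?_, fun i =>
    Or.inr (F.inner_pull_coord_eq_zero_of_isEven ha hp heven i)⟩
  rw [ha, hp] at h
  exact h

theorem norm_sub_rotate_rot3_ge {n : ℕ} {ψ : Modes n} (hψ : ‖ψ‖ = 1)
    (hε : distTo (gaussianStates n) ψ ≤ 1 / 128) :
    distTo (gaussianStates n) ψ / 4 ≤
      ‖tensorPow 3 ψ - rotate n (rot3 (Real.pi / 3)) (tensorPow 3 ψ)‖ := by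
  refine norm_tensorPow_sub_rotate_ge_of_distTo (r := 16 / 9) (by norm_num) (by norm_num) _
    (by norm_num) (by norm_num) sum_rot3_pow_le hψ
    (fun φ ⟨a, p, hφ⟩ => hφ.norm_eq_one) (fun φ ⟨a, p, hφ⟩ => ?_) hε
  obtain ⟨F, ha, hp, rfl⟩ := hφ.exists_frame
  -- The rotation fixes the axis (1,1,1), so its rows and columns sum to 1 and Gaussian states of
  -- any mean are allowed.
  refine ⟨F, rfl, Or.inl ?_, F.stays_in_coord_mul_coord fun φ h => ⟨_, _, h⟩, fun i =>
    Or.inl (F.stays_in_coord i)⟩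
  rw [rot3_pi_div_three]
  constructor <;> intro l <;> fin_cases l <;> simp [Fin.sum_univ_three] <;> norm_num

end Bosonic

end

theorem mainTheorem3 :
    ∃ ε₀ : ℝ, 0 < ε₀ ∧ ∃ c : ℝ, 0 < c ∧
      (∀ (n : ℕ) (ψ : Bosonic.Modes n), ‖ψ‖ = 1 → Bosonic.IsEven ψ →
        ∀ ε : ℝ, Bosonic.distTo (Bosonic.zeroMeanGaussianStates n) ψ = ε → ε ≤ ε₀ →
          Bosonic.acceptTest2 ψ ≤ 1 - c * ε ^ 2 ∧ Bosonic.acceptTest1 ψ ≤ 1 - c * ε ^ 2) ∧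
      (∀ (n : ℕ) (ψ : Bosonic.Modes n), ‖ψ‖ = 1 →
        ∀ ε : ℝ, Bosonic.distTo (Bosonic.gaussianStates n) ψ = ε → ε ≤ ε₀ →
          Bosonic.acceptTest5 ψ ≤ 1 - c * ε ^ 2 ∧ Bosonic.acceptTest4 ψ ≤ 1 - c * ε ^ 2) := by
  -- The threshold ensures ‖χ‖ ≤ 2ε ≤ 1/64. The constant 1/64 is ¼·(¼)², from the displacement bound
  -- ε/4 and the quarter in `acceptProb_le`.
  refine ⟨1 / 128, by norm_num, 1 / 64, by norm_num, ?_, ?_⟩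
  · rintro n ψ hψ heven _ rfl hε
    have h := Bosonic.norm_sub_rotate_rot2_ge hψ heven hε
    have h0 := Bosonic.distTo_nonneg (Bosonic.zeroMeanGaussianStates n) ψ
    exact ⟨Bosonic.acceptProb_le_of_norm_ge hψ (Set.mem_singleton _) h0 h,
      Bosonic.acceptProb_le_of_norm_ge hψ (Set.mem_insert_of_mem _ (Set.mem_range_self _)) h0 h⟩
  · rintro n ψ hψ _ rfl hε
    have h := Bosonic.norm_sub_rotate_rot3_ge hψ hε
    have h0 := Bosonic.distTo_nonneg (Bosonic.gaussianStates n) ψ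
    exact ⟨Bosonic.acceptProb_le_of_norm_ge hψ (Set.mem_singleton _) h0 h,
      Bosonic.acceptProb_le_of_norm_ge hψ (Set.mem_range_self _) h0 h⟩
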